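/- All languages are subsets of $\Sigma^*=\{0,1\}^*$, and a complexity class is any collection of languages. The disjoint union of languages $A,B$ is $A\oplus B=\{x0 : x\in A\}\cup\{x1 : x\in B\}$; a class $\mathcal C$ is closed under disjoint union if $A,B\in\mathcal C$ implies $A\oplus B\in\mathcal C$. Machines are deterministic polynomial-time oracle Turing machines whose polynomial time bound does not depend on the oracles. For complexity classes $\mathcal C,\mathcal D$, let each of the following be the class of all languages $L$ for which there are $C\in\mathcal C$, $D\in\mathcal D$ and such a machine that accepts exactly $L$ with oracles $C$ and $D$ and that, on every input, accesses the oracles as described: * $\mathrm P^{\mathcal C:\mathcal D}$: at most one query to $C$, followed by at most one query to $D$ (hence $\mathrm P^{\mathcal D:\mathcal C}$: at most one query to $D$, followed by at most one query to $C$); * $\mathrm P_{1,1\text{-tt}}^{(\mathcal C,\mathcal D)}$: at most one query to $C$ and at most one query to $D$, made simultaneously; * $\mathrm P^{\mathcal C,\mathcal D}$: at most one query to $C$ and at most one query to $D$, in arbitrary order. Write $A\le_m^{p,\mathcal D[1]}B$ if there is a total function $f$ that is computable in polynomial time with at most one query to some oracle $D\in\mathcal D$, such that for all $x\in\Sigma^*$,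 $x\in A\iff f(x)\in B$. Theorem. Let $\mathcal C$ and $\mathcal D$ be complexity classes such that $\mathcal C$ is closed downwards under $\le_m^{p,\mathcal D[1]}$ (that is, $A\le_m^{p,\mathcal D[1]}B$ and $B\in\mathcal C$ imply $A\in\mathcal C$), and both $\mathcal C$ and $\mathcal D$ are closed under disjoint union. Then $$\mathrm P_{1,1\text{-tt}}^{(\mathcal C,\mathcal D)}=\mathrm P^{\mathcal C:\mathcal D}=\mathrm P^{\mathcal D:\mathcal C}=\mathrm P^{\mathcal C,\mathcal D}.$$ -/

import Mathlib

namespace QueryOrder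

/-- A complexity class: a collection of languages over `{0, 1}` (`false` is `0`, `true` is `1`). -/
abbrev ComplexityClass := Set (Language Bool)

/-- What an oracle machine does in one step, with states `Q`, two-way tapes `K`, oracles `ι`.
* `halt b`: stop, accepting if `b = true` and rejecting otherwise.
* `move`: go to state `next`; on every two-way tape write a symbol and then move the head one cell
  (or leave it in place); append at most one bit to each write-only query tape and to the
  write-only output tape.
* `ask S next`: ask, simultaneously, each of the oracles `i ∈ S` about the word that stands on the
  query tape of `i`; the answers determine the next state and the query tapes used are erased.
  An ordinary query to the oracle `i` is the case `S = {i}`. -/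
inductive Action (Q K ι : Type) where
  | halt (b : Bool)
  | move (next : Q) (write : K → Option Bool) (dir : K → Option Turing.Dir)
      (emit : ι → Option Bool) (out : Option Bool)
  | ask (S : Finset ι) (next : (ι → Bool) → Q)

/-- A deterministic multitape oracle Turing machine with oracles indexed by `ι`. It has finitely
many states and finitely many two-way infinite tapes over `{0, 1, blank}` (`none` is the blank; a
larger tape alphabet amounts to several such tapes whose heads move in parallel), a query tape for
each oracle, and an output tape. The input stands on the tape `inp`. -/
structure OracleTM (ι : Type) where
  State : Type
  Tape : Type
  [finiteState : Finite State]
  [finiteTape : Finite Tape]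
  [decEqTape : DecidableEq Tape]
  inp : Tape
  start : State
  δ : State → (Tape → Option Bool) → Action State Tape ι

attribute [instance] OracleTM.finiteState OracleTM.finiteTape OracleTM.decEqTape

namespace OracleTM

variable {ι : Type} [DecidableEq ι]

/-- Configurations. The component `log` plays no role in the computation: it records, in
chronological order, the sets of oracles that have been asked. -/
structure Cfg (M : OracleTM ι) where
  state : M.State
  tape : M.Tape → Turing.Tape (Option Bool)
  query : ι → List Bool
  out : List Bool
  log : List (Finset ι)

/-- The initial configuration: the head of the input tape is on the first letter of `x`, and all
other tapes are empty. -/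
def init (M : OracleTM ι) (x : List Bool) : M.Cfg where
  state := M.start
  tape k := if k = M.inp then Turing.Tape.mk₁ (x.map some) else default
  query _ := []
  out := []
  log := []

/-- The action that the machine takes in a configuration. -/
def action (M : OracleTM ι) (c : M.Cfg) : Action M.State M.Tape ι :=
  M.δ c.state fun k => (c.tape k).head

open Classical in
/-- The answers to the queries to the oracles in `S` (`false` for the oracles not asked). -/
noncomputable def answers (O : ι → Language Bool) (S : Finset ι) (q : ι → List Bool) (i : ι) :
    Bool :=
  decide (i ∈ S ∧ q i ∈ O i)

/-- One step of the computation with oracles `O`; halting configurations stay unchanged. -/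
noncomputable def step (M : OracleTM ι) (O : ι → Language Bool) (c : M.Cfg) : M.Cfg :=
  match M.action c with
  | .halt _ => c
  | .move next write dir emit out =>
    { state := next
      tape := fun k =>
        match dir k with
        | none => (c.tape k).write (write k)
        | some d => ((c.tape k).write (write k)).move d
      query := fun i => c.query i ++ (emit i).toList
      out := c.out ++ out.toList
      log := c.log }
  | .ask S next =>
    { state := next (answers O S c.query)
      tape := c.tape
      query := fun i => if i ∈ S then [] else c.query i
      out := c.out
      log := c.log ++ [S] }

/-- The configuration after `t` steps on input `x` with oracles `O`. -/
noncomputable def run (M : OracleTM ι) (O : ι → Language Bool) (x : List Bool) (t : ℕ) : M.Cfg :=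
  (M.step O)^[t] (M.init x)

/-- `some b` if the configuration is halting, with verdict `b`; `none` otherwise. -/
def verdict (M : OracleTM ι) (c : M.Cfg) : Option Bool :=
  match M.action c with
  | .halt b => some b
  | _ => none

/-- `M` runs in polynomial time, with a bound that is independent of the oracles. -/
def PolyTime (M : OracleTM ι) : Prop :=
  ∃ p : Polynomial ℕ, ∀ (O : ι → Language Bool) (x : List Bool),
    ∃ t ≤ p.eval x.length, ∃ b, M.verdict (M.run O x t) = some b

/-- The language accepted by `M` with oracles `O`. -/
def accepted (M : OracleTM ι) (O : ι → Language Bool) : Language Bool :=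
  {x : List Bool | ∃ t, M.verdict (M.run O x t) = some true}

/-- `M` with oracles `O` computes the total function `f`. -/
def Computes (M : OracleTM ι) (O : ι → Language Bool) (f : List Bool → List Bool) : Prop :=
  ∀ x, ∃ t b, M.verdict (M.run O x t) = some b ∧ (M.run O x t).out = f x

/-- On every input, the sequence of sets of oracles asked by `M` with oracles `O` obeys `R`
throughout the computation. -/
def Obeys (M : OracleTM ι) (O : ι → Language Bool) (R : List (Finset ι) → Prop) : Prop :=
  ∀ x t, R (M.run O x t).log

end OracleTM

/-- `P^{𝒞 : 𝒟}`: at most one query to `C`, followed by at most one query to `D`. -/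
def POrdered (𝒞 𝒟 : ComplexityClass) : ComplexityClass :=
  {L | ∃ C ∈ 𝒞, ∃ D ∈ 𝒟, ∃ M : OracleTM (Fin 2), M.PolyTime ∧
    M.Obeys ![C, D] (fun l => l.Sublist [{0}, {1}]) ∧ L = M.accepted ![C, D]}

/-- `P_{1,1-tt}^{(𝒞, 𝒟)}`: simultaneously at most one query to `C` and at most one query to `D`,
that is, oracles are asked at most once, and what is asked then is asked at the same time. -/
def PParallel (𝒞 𝒟 : ComplexityClass) : ComplexityClass :=
  {L | ∃ C ∈ 𝒞, ∃ D ∈ 𝒟, ∃ M : OracleTM (Fin 2), M.PolyTime ∧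
    M.Obeys ![C, D] (fun l => l.length ≤ 1) ∧ L = M.accepted ![C, D]}

/-- `P^{𝒞, 𝒟}`: at most one query to `C` and at most one query to `D`, in arbitrary order (the
order may depend on the input). -/
def PUnordered (𝒞 𝒟 : ComplexityClass) : ComplexityClass :=
  {L | ∃ C ∈ 𝒞, ∃ D ∈ 𝒟, ∃ M : OracleTM (Fin 2), M.PolyTime ∧
    M.Obeys ![C, D] (fun l => l.Sublist [{0}, {1}] ∨ l.Sublist [{1}, {0}]) ∧
    L = M.accepted ![C, D]}

/-- `FP^{𝒟[1]}`: the total functions computable in polynomial time with at most one query to some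
member of `𝒟`. -/
def FPOneQuery (𝒟 : ComplexityClass) : Set (List Bool → List Bool) :=
  {f | ∃ D ∈ 𝒟, ∃ M : OracleTM (Fin 1), M.PolyTime ∧
    M.Obeys ![D] (fun l => l.length ≤ 1) ∧ M.Computes ![D] f}

/-- The reducibility `A ≤_m^{p, 𝒟[1]} B`. -/
def ManyOneReduces (𝒟 : ComplexityClass) (A B : Language Bool) : Prop :=
  ∃ f ∈ FPOneQuery 𝒟, ∀ x, x ∈ A ↔ f x ∈ B

/-- `𝒞` is closed downwards under `≤_m^{p, 𝒟[1]}`. -/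
def ClosedDownward (𝒞 𝒟 : ComplexityClass) : Prop :=
  ∀ A B : Language Bool, ManyOneReduces 𝒟 A B → B ∈ 𝒞 → A ∈ 𝒞

/-- The disjoint union `A ⊕ B = {x0 | x ∈ A} ∪ {x1 | x ∈ B}`. -/
def disjointUnion (A B : Language Bool) : Language Bool :=
  {w : List Bool | (∃ x ∈ A, w = x ++ [false]) ∨ (∃ x ∈ B, w = x ++ [true])}

/-- `𝒞` is closed under disjoint union. -/
def ClosedDisjointUnion (𝒞 : ComplexityClass) : Prop :=
  ∀ A ∈ 𝒞, ∀ B ∈ 𝒞, disjointUnion A B ∈ 𝒞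

end QueryOrder

set_option linter.unusedSectionVars false

open Turing (Dir Tape ListBlank)

namespace QueryOrder

/-! The heart is that a machine `M` asking `C` and `D` once each, in any order, can be replaced by
one that asks simultaneously, with a new language `G ∈ 𝒞` in place of `C` (`mem_PParallel`).

Suppose `M` on `x` asks `C` first, with query `q`. Let `v₊` and `v₋` be the verdicts that result
from a positive and a negative answer, the subsequent query to `D` being answered truthfully. Put `x
∈ G` iff `q ∈ C` and `v₊ ≠ v₋`. Then the true verdict is `v₋ xor [x ∈ G]`. The word `x` and the
query to `D` on the negative branch are both known in advance, so they can be asked together. If `M`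
asks `D` first, let `x ∈ G` iff the query to `C` that follows the true answer of `D` is in `C`;
again `x` and the query to `D` are known in advance.

Deciding `v₊ ≠ v₋` needs two queries to `D`, but a reduction may ask only one. Hence `G` is reached
by two reductions. The inner one, `appendBit`, maps `x` to `xb`, where `b` is `v₋` or the answer of
`D`. The outer one, `reduceQuery`, maps `xb` to the query to `C` followed by a bit that is `0` iff
this query matters; membership is then tested in `C ⊕ ∅`. Downward closure is applied once for each
reduction.

Conversely, simultaneous queries can be asked one after the other in either order (`mem_POrdered`),
and the remaining inclusions are formal.

All new machines are instances of one construction, `control`, which runs `M` and intercepts its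
queries and its halting. The simulation also follows branches with false answers, where `M` need not
respect the query limits. It halts there in time because the time bound does not depend on the
oracles, and surplus queries are given a fixed default verdict. -/

theorem polynomial_eval_mono (p : Polynomial ℕ) {m n : ℕ} (h : m ≤ n) : p.eval m ≤ p.eval n := by
  induction p using Polynomial.induction_on' with
  | add p q hp hq => simpa only [Polynomial.eval_add] using Nat.add_le_add hp hq
  | monomial k a =>
    simp only [Polynomial.eval_monomial]
    exact Nat.mul_le_mul_left _ (Nat.pow_le_pow_left h k)

/-! ### Computation up to the next query or halt. -/

namespace OracleTM

variable {ι : Type} [DecidableEq ι]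

/-- The set of oracles that `M` asks in the configuration `c`, if it asks any. -/
def asks (M : OracleTM ι) (c : M.Cfg) : Option (Finset ι) :=
  match M.action c with
  | .ask S _ => some S
  | _ => none

/-- The configuration that follows an asking configuration when the answers are `a`. -/
def reply (M : OracleTM ι) (c : M.Cfg) (a : ι → Bool) : M.Cfg :=
  match M.action c with
  | .ask S next =>
    { state := next a
      tape := c.tape
      query := fun i => if i ∈ S then [] else c.query i
      out := c.out
      log := c.log ++ [S] }
  | _ => c

/-- The action in `c` is neither a query nor halting. -/
def IsMove (M : OracleTM ι) (c : M.Cfg) : Prop :=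
  M.verdict c = none ∧ M.asks c = none

theorem isMove_iff (M : OracleTM ι) (c : M.Cfg) :
    M.IsMove c ↔ ∃ nx wr dir em out, M.action c = .move nx wr dir em out := by
  unfold IsMove verdict asks
  cases M.action c <;> simp

theorem verdict_eq_some (M : OracleTM ι) {c : M.Cfg} {b : Bool} :
    M.verdict c = some b ↔ M.action c = .halt b := by
  unfold verdict
  cases M.action c <;> simp

theorem asks_eq_some (M : OracleTM ι) {c : M.Cfg} {S : Finset ι} :
    M.asks c = some S ↔ ∃ next, M.action c = .ask S next := by
  unfold asks
  cases M.action c <;> simp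

theorem step_of_asks (M : OracleTM ι) (O : ι → Language Bool) {c : M.Cfg} {S : Finset ι}
    (h : M.asks c = some S) : M.step O c = M.reply c (answers O S c.query) := by
  obtain ⟨next, h⟩ := M.asks_eq_some.1 h
  simp [step, reply, h]

theorem step_of_verdict (M : OracleTM ι) (O : ι → Language Bool) {c : M.Cfg} {b : Bool}
    (h : M.verdict c = some b) : M.step O c = c := by
  rw [verdict_eq_some] at h
  simp [step, h]

theorem reply_log (M : OracleTM ι) {c : M.Cfg} {S : Finset ι} (h : M.asks c = some S)
    (a : ι → Bool) : (M.reply c a).log = c.log ++ [S] := by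
  obtain ⟨next, h⟩ := M.asks_eq_some.1 h
  simp [reply, h]

theorem reply_query (M : OracleTM ι) {c : M.Cfg} {S : Finset ι} (h : M.asks c = some S)
    (a : ι → Bool) (i : ι) : (M.reply c a).query i = if i ∈ S then [] else c.query i := by
  obtain ⟨next, h⟩ := M.asks_eq_some.1 h
  simp [reply, h]

/-- One step, with the empty oracles. -/
noncomputable def advance (M : OracleTM ι) (c : M.Cfg) : M.Cfg :=
  M.step (fun _ => (∅ : Set (List Bool))) c

/-- Oracles enter only through queries, so the choice of the empty oracles in `advance` is
immaterial. -/
theorem step_of_isMove (M : OracleTM ι) (O : ι → Language Bool) {c : M.Cfg} (h : M.IsMove c) :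
    M.step O c = M.advance c := by
  obtain ⟨_, _, _, _, _, h⟩ := (M.isMove_iff c).1 h
  simp [advance, step, h]

/-- The number of steps before the first query, or before halting. -/
noncomputable def pauseTime (M : OracleTM ι) (c : M.Cfg) : ℕ :=
  sInf {n | ¬ M.IsMove (M.advance^[n] c)}

/-- The first configuration in which the machine asks or halts. -/
noncomputable def pause (M : OracleTM ι) (c : M.Cfg) : M.Cfg :=
  M.advance^[M.pauseTime c] c

theorem isMove_of_lt_pauseTime (M : OracleTM ι) {c : M.Cfg} {n : ℕ} (h : n < M.pauseTime c) :
    M.IsMove (M.advance^[n] c) := by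
  by_contra hn
  exact Nat.notMem_of_lt_sInf h hn

theorem iterate_step_of_isMove (M : OracleTM ι) (O : ι → Language Bool) {c : M.Cfg} {n : ℕ}
    (h : ∀ j < n, M.IsMove (M.advance^[j] c)) : (M.step O)^[n] c = M.advance^[n] c := by
  induction n with
  | zero => rfl
  | succ n ih =>
    rw [Function.iterate_succ_apply', Function.iterate_succ_apply',
      ih fun j hj => h j (by omega), M.step_of_isMove O (h n (by omega))]

theorem iterate_step_pauseTime (M : OracleTM ι) (O : ι → Language Bool) (c : M.Cfg) :
    (M.step O)^[M.pauseTime c] c = M.pause c :=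
  M.iterate_step_of_isMove O fun _ => M.isMove_of_lt_pauseTime

theorem advance_log (M : OracleTM ι) {c : M.Cfg} (h : M.IsMove c) :
    (M.advance c).log = c.log := by
  obtain ⟨_, _, _, _, _, h⟩ := (M.isMove_iff c).1 h
  simp [advance, step, h]

theorem pause_log (M : OracleTM ι) (c : M.Cfg) : (M.pause c).log = c.log := by
  have : ∀ n ≤ M.pauseTime c, (M.advance^[n] c).log = c.log := by
    intro n
    induction n with
    | zero => simp
    | succ n ih =>
      intro hn
      rw [Function.iterate_succ_apply', M.advance_log (M.isMove_of_lt_pauseTime (by omega)),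
        ih (by omega)]
  exact this _ le_rfl

theorem iterate_step_of_verdict (M : OracleTM ι) (O : ι → Language Bool) {c : M.Cfg} {b : Bool}
    (h : M.verdict c = some b) (n : ℕ) : (M.step O)^[n] c = c := by
  induction n with
  | zero => rfl
  | succ n ih => rw [Function.iterate_succ_apply, M.step_of_verdict O h, ih]

/-! ### Running times with constant answers -/

/-- The oracles that give the constant answers `E`. -/
def constOracle (E : ι → Bool) (i : ι) : Language Bool :=
  {_w : List Bool | E i = true}

theorem answers_constOracle (E : ι → Bool) (S : Finset ι) (q : ι → List Bool) :
    answers (constOracle E) S q = fun i => decide (i ∈ S) && E i := by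
  funext i
  have : q i ∈ constOracle E i ↔ E i = true := Iff.rfl
  by_cases h : i ∈ S <;> cases hE : E i <;> simp [answers, h, this, hE]

/-- From `c`, the machine halts within `T` steps when the answers are given by `E`. -/
def HaltsIn (M : OracleTM ι) (E : ι → Bool) (T : ℕ) (c : M.Cfg) : Prop :=
  ∃ t ≤ T, ∃ b, M.verdict ((M.step (constOracle E))^[t] c) = some b

variable {M : OracleTM ι} {E : ι → Bool} {T : ℕ} {c : M.Cfg}

/-- The infimum `pauseTime` is meaningful only if some configuration is not a move. If the
configurations up to time `t` were all moves, the run would not depend on the oracles and could not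
be halting at time `t`. -/
theorem pauseTime_le_and_not_isMove {O : ι → Language Bool} {t : ℕ} {b : Bool}
    (hb : M.verdict ((M.step O)^[t] c) = some b) :
    M.pauseTime c ≤ t ∧ ¬ M.IsMove (M.pause c) := by
  have key : M.pauseTime c ≤ t ∧ {n | ¬ M.IsMove (M.advance^[n] c)}.Nonempty := by
    by_contra hcon
    have hall : ∀ j ≤ t, M.IsMove (M.advance^[j] c) := by
      intro j hj
      by_contra hn
      exact hcon ⟨(Nat.sInf_le hn).trans hj, ⟨j, hn⟩⟩
    rw [M.iterate_step_of_isMove _ fun j hj => hall j hj.le] at hb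
    simp [(hall t le_rfl).1] at hb
  exact ⟨key.1, Nat.sInf_mem key.2⟩

theorem verdict_or_asks_of_not_isMove (h : ¬ M.IsMove c) :
    (∃ v, M.verdict c = some v) ∨ ∃ S, M.asks c = some S := by
  unfold IsMove at h
  cases hv : M.verdict c
  · exact .inr (Option.ne_none_iff_exists'.1 fun ha => h ⟨hv, ha⟩)
  · exact .inl ⟨_, rfl⟩

theorem HaltsIn.pauseTime_le (h : M.HaltsIn E T c) : M.pauseTime c ≤ T := by
  obtain ⟨t, htT, b, hb⟩ := h
  exact (pauseTime_le_and_not_isMove hb).1.trans htT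

theorem HaltsIn.pause (h : M.HaltsIn E T c) : M.HaltsIn E (T - M.pauseTime c) (M.pause c) := by
  obtain ⟨t, htT, b, hb⟩ := h
  have := (pauseTime_le_and_not_isMove hb).1
  refine ⟨t - M.pauseTime c, by omega, b, ?_⟩
  rw [← M.iterate_step_pauseTime (constOracle E), ← Function.iterate_add_apply,
    Nat.sub_add_cancel this, hb]

theorem HaltsIn.verdict_or_asks (h : M.HaltsIn E T c) :
    (∃ v, M.verdict (M.pause c) = some v) ∨ ∃ S, M.asks (M.pause c) = some S := by
  obtain ⟨t, htT, b, hb⟩ := h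
  exact verdict_or_asks_of_not_isMove (pauseTime_le_and_not_isMove hb).2

theorem HaltsIn.pos {S : Finset ι} (h : M.HaltsIn E T c) (hc : M.asks c = some S) : 0 < T := by
  obtain ⟨t, htT, b, hb⟩ := h
  rcases t with _ | t
  · obtain ⟨next, hc⟩ := M.asks_eq_some.1 hc
    simp [verdict, hc] at hb
  · omega

theorem HaltsIn.reply {S : Finset ι} (h : M.HaltsIn E T c) (hc : M.asks c = some S) :
    M.HaltsIn E (T - 1) (M.reply c fun i => decide (i ∈ S) && E i) := by
  obtain ⟨t, htT, b, hb⟩ := h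
  cases t with
  | zero =>
    obtain ⟨next, hc⟩ := M.asks_eq_some.1 hc
    simp [verdict, hc] at hb
  | succ t =>
    refine ⟨t, by omega, b, ?_⟩
    rwa [Function.iterate_succ_apply, M.step_of_asks _ hc, answers_constOracle] at hb

/-- Makes the time bound available on branches with false answers. Constant answers suffice, since
no simulation feeds `M` more than one answer of each oracle. -/
theorem PolyTime.haltsIn {p : Polynomial ℕ}
    (hp : ∀ (O : ι → Language Bool) (x : List Bool),
      ∃ t ≤ p.eval x.length, ∃ b, M.verdict (M.run O x t) = some b) (E : ι → Bool)
    (x : List Bool) : M.HaltsIn E (p.eval x.length) (M.init x) :=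
  hp (constOracle E) x

/-! ### Results of computations -/

/-- From `c`, the machine halts within `T` steps with verdict `v`, output `o` and log `l`. -/
def Yields (M : OracleTM ι) (O : ι → Language Bool) (c : M.Cfg) (T : ℕ) (v : Bool)
    (o : List Bool) (l : List (Finset ι)) : Prop :=
  ∃ t ≤ T, M.verdict ((M.step O)^[t] c) = some v ∧ ((M.step O)^[t] c).out = o ∧
    ((M.step O)^[t] c).log = l

variable {O : ι → Language Bool} {v : Bool} {o : List Bool} {l : List (Finset ι)} {x : List Bool}

theorem Yields.of_verdict (h : M.verdict c = some v) (T : ℕ) : M.Yields O c T v c.out c.log :=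
  ⟨0, by omega, h, rfl, rfl⟩

theorem Yields.of_iterate {n : ℕ} {c' : M.Cfg} (hc : (M.step O)^[n] c = c')
    (h : M.Yields O c' T v o l) : M.Yields O c (T + n) v o l := by
  obtain ⟨t, ht, h⟩ := h
  refine ⟨t + n, by omega, ?_⟩
  rw [Function.iterate_add_apply, hc]
  exact h

theorem Yields.of_step {c' : M.Cfg} (hc : M.step O c = c') (h : M.Yields O c' T v o l) :
    M.Yields O c (T + 1) v o l :=
  Yields.of_iterate (n := 1) hc h

theorem Yields.mono {T' : ℕ} (h : M.Yields O c T v o l) (hT : T ≤ T') : M.Yields O c T' v o l := by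
  obtain ⟨t, ht, h⟩ := h
  exact ⟨t, ht.trans hT, h⟩

theorem run_add (M : OracleTM ι) (O : ι → Language Bool) (x : List Bool) (m n : ℕ) :
    M.run O x (m + n) = (M.step O)^[m] (M.run O x n) := by
  simp [run, Function.iterate_add_apply]

theorem run_eq_of_verdict {t : ℕ} (h : M.verdict (M.run O x t) = some v) {s : ℕ} (hs : t ≤ s) :
    M.run O x s = M.run O x t := by
  obtain ⟨d, rfl⟩ := Nat.exists_eq_add_of_le' hs
  rw [run_add, M.iterate_step_of_verdict O h]

theorem mem_accepted_iff {t : ℕ} (h : M.verdict (M.run O x t) = some v) :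
    x ∈ M.accepted O ↔ v = true := by
  constructor
  · rintro ⟨s, hs⟩
    rcases le_total t s with hts | hts
    · rw [run_eq_of_verdict h hts, h] at hs
      simpa using hs
    · rw [run_eq_of_verdict hs hts, hs] at h
      simpa using h.symm
  · rintro rfl
    exact ⟨t, h⟩

theorem step_log_prefix (M : OracleTM ι) (O : ι → Language Bool) (c : M.Cfg) :
    c.log <+: (M.step O c).log := by
  unfold step
  cases M.action c <;> simp

theorem iterate_step_log_prefix (M : OracleTM ι) (O : ι → Language Bool) (n : ℕ) (c : M.Cfg) :
    c.log <+: ((M.step O)^[n] c).log := by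
  induction n with
  | zero => simp
  | succ n ih =>
    rw [Function.iterate_succ_apply']
    exact ih.trans (M.step_log_prefix O _)

theorem Yields.mem_accepted_iff (h : M.Yields O (M.init x) T v o l) :
    x ∈ M.accepted O ↔ v = true := by
  obtain ⟨t, -, ht, -⟩ := h
  exact OracleTM.mem_accepted_iff (O := O) ht

/-- Logs only grow and halting configurations are fixed, so a query discipline that passes to
prefixes need only be checked on the final log. -/
theorem Yields.log_prefix (h : M.Yields O (M.init x) T v o l) (t : ℕ) :
    (M.run O x t).log <+: l := by
  obtain ⟨s, -, hs, -, rfl⟩ := h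
  rcases le_total s t with hst | hst
  · rw [run_eq_of_verdict hs hst]
    exact List.prefix_rfl
  · obtain ⟨d, rfl⟩ := Nat.exists_eq_add_of_le' hst
    have := M.iterate_step_log_prefix O d (M.run O x t)
    rwa [← run_add] at this

/-- The configuration `c` occurs in the computation on input `x`. -/
def Reaches (M : OracleTM ι) (O : ι → Language Bool) (x : List Bool) (c : M.Cfg) : Prop :=
  ∃ t, M.run O x t = c

theorem reaches_init (M : OracleTM ι) (O : ι → Language Bool) (x : List Bool) :
    M.Reaches O x (M.init x) :=
  ⟨0, rfl⟩

theorem Reaches.pause (h : M.Reaches O x c) : M.Reaches O x (M.pause c) := by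
  obtain ⟨t, rfl⟩ := h
  exact ⟨_, by rw [run_add, M.iterate_step_pauseTime O]⟩

theorem Reaches.reply {S : Finset ι} (h : M.Reaches O x c) (hc : M.asks c = some S) :
    M.Reaches O x (M.reply c (answers O S c.query)) := by
  obtain ⟨t, rfl⟩ := h
  exact ⟨1 + t, by rw [run_add, Function.iterate_one, M.step_of_asks O hc]⟩

theorem Reaches.mem_accepted_iff (h : M.Reaches O x c) (hc : M.verdict c = some v) :
    x ∈ M.accepted O ↔ v = true := by
  obtain ⟨t, rfl⟩ := h
  exact OracleTM.mem_accepted_iff hc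

theorem Reaches.obeys {R : List (Finset ι) → Prop} (h : M.Reaches O x c) (hR : M.Obeys O R) :
    R c.log := by
  obtain ⟨t, rfl⟩ := h
  exact hR x t

/-- Answers to a query to the single oracle `i`. -/
def single (i : ι) (e : Bool) (j : ι) : Bool :=
  decide (j = i) && e

open Classical in
theorem answers_singleton (O : ι → Language Bool) (i : ι) (q : ι → List Bool) :
    answers O {i} q = single i (decide (q i ∈ O i)) := by
  funext j
  by_cases h : j = i
  · subst h; simp [answers, single]
  · simp [answers, single, h]

theorem HaltsIn.reply_singleton {i : ι} (h : M.HaltsIn E T c) (hc : M.asks c = some {i}) :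
    M.HaltsIn E (T - 1) (M.reply c (single i (E i))) := by
  have : (fun j => decide (j ∈ ({i} : Finset ι)) && E j) = single i (E i) := by
    funext j
    by_cases h : j = i
    · subst h; simp [single]
    · simp [single, h]
  exact this ▸ h.reply hc

/-- The verdict, if `M` halts without asking; otherwise `false`. -/
noncomputable def final (M : OracleTM ι) (c : M.Cfg) : Bool :=
  (M.verdict (M.pause c)).getD false

theorem final_eq (h : M.verdict (M.pause c) = some v) : M.final c = v := by
  simp [final, h]

open Classical in
/-- The verdict, if `M` asks at most one query to the oracle `i`, and this oracle is `D`. -/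
noncomputable def finalAfterQuery (M : OracleTM ι) (i : ι) (D : Language Bool) (c : M.Cfg) :
    Bool :=
  if M.asks (M.pause c) = some {i} then
    M.final (M.reply (M.pause c) (single i (decide ((M.pause c).query i ∈ D))))
  else M.final c

theorem asks_of_verdict (h : M.verdict c = some v) : M.asks c = none := by
  rw [verdict_eq_some] at h
  simp [asks, h]

theorem verdict_of_asks {S : Finset ι} (h : M.asks c = some S) : M.verdict c = none := by
  obtain ⟨next, h⟩ := M.asks_eq_some.1 h
  simp [verdict, h]

end OracleTM

end QueryOrder

/-! ### Controllers: running a machine while intercepting its queries and its verdict. -/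

namespace QueryOrder

/-- What a controller does when the controlled machine asks or halts.
* `feed a k`: let the controlled machine continue as if the answers were `a`.
* `query S k`: ask the oracles in `S`.
* `emit b k`: append `b` to the output.
* `halt b`: end.
After `query` and `emit` the controlled machine is still in the same configuration. -/
inductive Command (ι ι' K : Type) where
  | feed (a : ι → Bool) (k : K)
  | query (S : Finset ι') (k : (ι' → Bool) → K)
  | emit (b : Bool) (k : K)
  | halt (b : Bool)

/-- A controller for machines with oracles `ι`, with oracles `ι'` of its own. -/
structure Controller (ι ι' K : Type) where
  /-- the last letter of the input is removed before the controlled machine starts -/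
  strip : Bool
  /-- the oracles to whose query tape the input is copied first -/
  copyQuery : ι' → Bool
  /-- the input is copied to the output tape first -/
  copyOut : Bool
  /-- the state in which the controlled machine starts, given the last letter of the input -/
  start : Bool → K
  /-- the query tape of the controlled machine that is recorded on a query tape -/
  source : K → ι' → Option ι
  /-- the query tape of the controlled machine that is recorded on the output tape -/
  outSource : K → Option ι
  onAsk : K → Finset ι → Command ι ι' K
  onHalt : K → Bool → Command ι ι' K

/-- The input of the controlled machine. -/
def Controller.input {ι ι' K : Type} (P : Controller ι ι' K) (w : List Bool) : List Bool :=
  if P.strip then w.dropLast else w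

/-- The states in which the input is copied. -/
inductive Preparation where
  | scan
  | turn
  | back (b : Bool)
  deriving Fintype

/-- The action that carries out a command. -/
def Command.action {ι ι' K Q T : Type} (q : Q) (next : (ι → Bool) → Q) (h : T → Option Bool) :
    Command ι ι' K → Action (Preparation ⊕ (Q × K)) T ι'
  | .feed a k => .move (.inr (next a, k)) h (fun _ => none) (fun _ => none) none
  | .query S k => .ask S fun r => .inr (q, k r)
  | .emit b k => .move (.inr (q, k)) h (fun _ => none) (fun _ => none) (some b)
  | .halt b => .halt b

namespace OracleTM

variable {ι ι' K : Type} [DecidableEq ι] [DecidableEq ι'] [Finite K]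

/-- The machine that prepares its tapes and then runs `M` under the control of `P`. -/
def control (M : OracleTM ι) (P : Controller ι ι' K) : OracleTM ι' where
  State := Preparation ⊕ (M.State × K)
  Tape := M.Tape
  inp := M.inp
  start := .inl .scan
  δ q h :=
    match q with
    | .inl .scan =>
      match h M.inp with
      | some b => .move (.inl .scan) h (fun k => if k = M.inp then some .right else none)
          (fun i => if P.copyQuery i then some b else none) (if P.copyOut then some b else none)
      | none => .move (.inl .turn) h (fun k => if k = M.inp then some .left else none)
          (fun _ => none) none
    | .inl .turn =>
      match h M.inp with
      | some b => .move (.inl (.back b))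
          (fun k => if k = M.inp then (if P.strip then none else some b) else h k)
          (fun k => if k = M.inp then some .left else none) (fun _ => none) none
      | none => .move (.inr (M.start, P.start false)) h
          (fun k => if k = M.inp then some .right else none) (fun _ => none) none
    | .inl (.back b) =>
      match h M.inp with
      | some _ => .move (.inl (.back b)) h
          (fun k => if k = M.inp then some .left else none) (fun _ => none) none
      | none => .move (.inr (M.start, P.start b)) h
          (fun k => if k = M.inp then some .right else none) (fun _ => none) none
    | .inr (q, k) =>
      match M.δ q h with
      | .halt b => (P.onHalt k b).action q (fun _ => q) h
      -- The output of `M` is dropped; during moves the output tape receives only a recorded query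
      -- tape.
      | .move next write dir emit _ => .move (.inr (next, k)) write dir
          (fun j => (P.source k j).bind emit) ((P.outSource k).bind emit)
      | .ask S next => (P.onAsk k S).action q next h

variable {M : OracleTM ι} {P : Controller ι ι' K} {O : ι' → Language Bool}

/-- The configuration of `M.control P` in which `M` has the configuration `c` and the controller
the state `k`. The contents `X` and `Y` concern the tapes that do not record a tape of `M`. -/
def conf (P : Controller ι ι' K) (k : K) (c : M.Cfg) (X : ι' → List Bool) (Y : List Bool)
    (l : List (Finset ι')) : (M.control P).Cfg where
  state := .inr (c.state, k)
  tape := c.tape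
  query j := (P.source k j).elim (X j) c.query
  out := (P.outSource k).elim Y c.query
  log := l

variable {k : K} {c : M.Cfg} {X : ι' → List Bool} {Y : List Bool} {l : List (Finset ι')}

/-- Both machines share the two-way tapes, and every recording tape receives the bits that `M`
writes on its source, so moves correspond one to one. -/
theorem step_conf_of_isMove (h : M.IsMove c) :
    (M.control P).step O (conf P k c X Y l) = conf P k (M.advance c) X Y l := by
  obtain ⟨nx, wr, dir, em, out', h⟩ := (M.isMove_iff c).1 h
  have h' : (M.control P).action (conf P k c X Y l) = .move (.inr (nx, k)) wr dir
      (fun j => (P.source k j).bind em) ((P.outSource k).bind em) := by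
    unfold action at h ⊢
    simp only [control, conf]
    rw [h]
  simp only [step, advance, h, h']
  simp only [conf]
  congr 1
  · funext j
    cases P.source k j <;> simp
  · cases P.outSource k <;> simp

theorem iterate_step_conf (k : K) (c : M.Cfg) (X : ι' → List Bool) (Y : List Bool)
    (l : List (Finset ι')) :
    ((M.control P).step O)^[M.pauseTime c] (conf P k c X Y l) = conf P k (M.pause c) X Y l := by
  have : ∀ n ≤ M.pauseTime c, ((M.control P).step O)^[n] (conf P k c X Y l) =
      conf P k (M.advance^[n] c) X Y l := by
    intro n
    induction n with
    | zero => intro _; rfl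
    | succ n ih =>
      intro hn
      rw [Function.iterate_succ_apply', Function.iterate_succ_apply', ih (by omega),
        step_conf_of_isMove (M.isMove_of_lt_pauseTime (by omega))]
  exact this _ le_rfl

theorem action_conf_of_asks {S : Finset ι} (h : M.asks c = some S) :
    (M.control P).action (conf P k c X Y l) =
      (P.onAsk k S).action c.state (fun a => (M.reply c a).state) fun i => (c.tape i).head := by
  obtain ⟨next, h⟩ := M.asks_eq_some.1 h
  have hr : (fun a => (M.reply c a).state) = next := by
    funext a
    simp [reply, h]
  rw [hr]
  unfold action at h ⊢
  simp only [control, conf]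
  rw [h]

theorem action_conf_of_verdict {v : Bool} (h : M.verdict c = some v) :
    (M.control P).action (conf P k c X Y l) =
      (P.onHalt k v).action c.state (fun _ => c.state) fun i => (c.tape i).head := by
  rw [verdict_eq_some] at h
  unfold action at h ⊢
  simp only [control, conf]
  rw [h]

/-- The command that the controller gives in a configuration in which `M` asks or halts. -/
def Commands (P : Controller ι ι' K) (k : K) (c : M.Cfg) (m : Command ι ι' K) : Prop :=
  (∃ S, M.asks c = some S ∧ P.onAsk k S = m) ∨
    (∃ v, M.verdict c = some v ∧ P.onHalt k v = m)

theorem action_conf_of_commands {m : Command ι ι' K} (h : Commands P k c m) :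
    ∃ next, (M.control P).action (conf P k c X Y l) =
      m.action c.state next fun i => (c.tape i).head := by
  rcases h with ⟨S, h, rfl⟩ | ⟨v, h, rfl⟩
  · exact ⟨_, action_conf_of_asks h⟩
  · exact ⟨_, action_conf_of_verdict h⟩

variable {T : ℕ} {v : Bool} {o : List Bool} {l' : List (Finset ι')}

theorem yields_conf_pause (h : (M.control P).Yields O (conf P k (M.pause c) X Y l) T v o l') :
    (M.control P).Yields O (conf P k c X Y l) (T + M.pauseTime c) v o l' :=
  Yields.of_iterate (iterate_step_conf k c X Y l) h

theorem yields_conf_halt (h : Commands P k c (.halt v)) (hY : (P.outSource k).elim Y c.query = o) :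
    (M.control P).Yields O (conf P k c X Y l) T v o l := by
  obtain ⟨next, ha⟩ := action_conf_of_commands (X := X) (Y := Y) (l := l) h
  subst hY
  exact Yields.of_verdict (((M.control P).verdict_eq_some).2 ha) T

/-- A new controller state may record different tapes. The hypotheses `hX` and `hY` say that the
actual contents agree under the old and the new description; likewise in the next two lemmas. -/
theorem yields_conf_emit {b : Bool} {k' : K} {X' : ι' → List Bool} {Y' : List Bool}
    (h : Commands P k c (.emit b k'))
    (hX : ∀ j, (P.source k j).elim (X j) c.query = (P.source k' j).elim (X' j) c.query)
    (hY : (P.outSource k).elim Y c.query ++ [b] = (P.outSource k').elim Y' c.query)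
    (hy : (M.control P).Yields O (conf P k' c X' Y' l) T v o l') :
    (M.control P).Yields O (conf P k c X Y l) (T + 1) v o l' := by
  obtain ⟨next, ha⟩ := action_conf_of_commands (X := X) (Y := Y) (l := l) h
  refine Yields.of_step ?_ hy
  simp only [step, ha, Command.action]
  simp [conf, hX, hY]

theorem yields_conf_query {S : Finset ι'} {g : (ι' → Bool) → K} {X' : ι' → List Bool}
    {Y' : List Bool} {a : ι' → Bool} (h : Commands P k c (.query S g))
    (hal : answers O S (fun j => (P.source k j).elim (X j) c.query) = a)
    (hX : ∀ j, (if j ∈ S then [] else (P.source k j).elim (X j) c.query) =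
      (P.source (g a) j).elim (X' j) c.query)
    (hY : (P.outSource k).elim Y c.query = (P.outSource (g a)).elim Y' c.query)
    (hy : (M.control P).Yields O (conf P (g a) c X' Y' (l ++ [S])) T v o l') :
    (M.control P).Yields O (conf P k c X Y l) (T + 1) v o l' := by
  obtain ⟨next, ha⟩ := action_conf_of_commands (X := X) (Y := Y) (l := l) h
  refine Yields.of_step ?_ hy
  simp only [step, ha, Command.action]
  subst hal
  simp [conf, hX, hY]

theorem yields_conf_feed {S : Finset ι} {a : ι → Bool} {k' : K} {X' : ι' → List Bool}
    {Y' : List Bool} (hS : M.asks c = some S) (h : P.onAsk k S = .feed a k')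
    (hX : ∀ j, (P.source k j).elim (X j) c.query =
      (P.source k' j).elim (X' j) (M.reply c a).query)
    (hY : (P.outSource k).elim Y c.query = (P.outSource k').elim Y' (M.reply c a).query)
    (hy : (M.control P).Yields O (conf P k' (M.reply c a) X' Y' l) T v o l') :
    (M.control P).Yields O (conf P k c X Y l) (T + 1) v o l' := by
  have ha := action_conf_of_asks (P := P) (k := k) (X := X) (Y := Y) (l := l) hS
  have ht : (M.reply c a).tape = c.tape := by
    unfold reply
    cases M.action c <;> rfl
  refine Yields.of_step ?_ hy
  rw [h] at ha
  simp only [step, ha, Command.action]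
  simp [conf, hX, hY, ht]

/-! ### The preparation -/

/-- The configurations of the preparation; `t` is the input tape. -/
def prep (P : Controller ι ι' K) (q : (M.control P).State) (t : Turing.Tape (Option Bool))
    (w : List Bool) : (M.control P).Cfg where
  state := q
  tape := fun i : M.Tape => if i = M.inp then t else default
  query j := if P.copyQuery j then w else []
  out := if P.copyOut then w else []
  log := []

/-- The head symbols when the input tape has the head symbol `a` and the other tapes are empty. -/
def prepHeads (M : OracleTM ι) (a : Option Bool) (i : M.Tape) : Option Bool :=
  if i = M.inp then a else none

theorem step_prep {q q' : (M.control P).State} {t : Turing.Tape (Option Bool)} {w : List Bool}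
    {a e : Option Bool} {d : Dir}
    (h : (M.control P).δ q (M.prepHeads t.head) =
      .move q' (M.prepHeads a) (fun i : M.Tape => if i = M.inp then some d else none)
        (fun j => if P.copyQuery j then e else none) (if P.copyOut then e else none)) :
    (M.control P).step O (prep P q t w) = prep P q' ((t.write a).move d) (w ++ e.toList) := by
  have ha : (M.control P).action (prep P q t w) =
      .move q' (M.prepHeads a) (fun i : M.Tape => if i = M.inp then some d else none)
        (fun j => if P.copyQuery j then e else none) (if P.copyOut then e else none) := by
    rw [← h]
    unfold action prep
    congr 1
    refine funext fun i : M.Tape => ?_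
    by_cases hi : i = M.inp
    · simp [hi, prepHeads]
    · simp only [hi, if_false, prepHeads]; rfl
  simp only [step, ha]
  simp only [prep]
  congr 1
  · refine funext fun i : M.Tape => ?_
    by_cases hi : i = M.inp
    · subst hi
      simp [prepHeads]
    · simp only [hi, if_false, prepHeads]
      rfl
  · funext j
    cases P.copyQuery j <;> simp
  · cases P.copyOut <;> simp

theorem mk₂_head_cons (L R : List (Option Bool)) (a : Option Bool) :
    (Turing.Tape.mk₂ L (a :: R)).head = a := by
  simp [Turing.Tape.mk₂]

theorem mk₂_head_nil (L : List (Option Bool)) :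
    (Turing.Tape.mk₂ L []).head = none := by
  simp only [Turing.Tape.mk₂]
  rfl

theorem mk₂_move_left_cons (a : Option Bool) (L R : List (Option Bool)) :
    (Turing.Tape.mk₂ (a :: L) R).move .left = Turing.Tape.mk₂ L (a :: R) := by
  simp [Turing.Tape.mk₂]

theorem mk₂_move_left_nil_head (R : List (Option Bool)) :
    ((Turing.Tape.mk₂ [] R).move .left).head = none := by
  simp only [Turing.Tape.mk₂]
  rfl

theorem mk₂_move_right_cons (a : Option Bool) (L R : List (Option Bool)) :
    (Turing.Tape.mk₂ L (a :: R)).move .right = Turing.Tape.mk₂ (a :: L) R := by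
  simp [Turing.Tape.mk₂]

theorem mk₂_write_cons (a b : Option Bool) (L R : List (Option Bool)) :
    (Turing.Tape.mk₂ L (a :: R)).write b = Turing.Tape.mk₂ L (b :: R) := by
  simp [Turing.Tape.mk₂]

/-- Half-tapes are lists modulo trailing blanks, so blanking the last letter leaves exactly the
initial tape of the shortened input. -/
theorem mk₂_append_none (l : List (Option Bool)) :
    Turing.Tape.mk₂ [] (l ++ [none]) = Turing.Tape.mk₁ l := by
  have : ListBlank.mk (l ++ [none]) = ListBlank.mk l :=
    (Quotient.sound' (Or.inl ⟨1, rfl⟩)).symm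
  simp only [Turing.Tape.mk₁, Turing.Tape.mk₂, this]

theorem write_move_of_head {t : Turing.Tape (Option Bool)} {a : Option Bool} (h : t.head = a) :
    t.write a = t := by
  subst h
  exact t.write_self

theorem iterate_scan (O : ι' → Language Bool) (u : List Bool) :
    ∀ (L : List (Option Bool)) (w : List Bool),
    ((M.control P).step O)^[u.length]
        (prep P (.inl .scan) (Turing.Tape.mk₂ L (u.map some)) w) =
      prep P (.inl .scan) (Turing.Tape.mk₂ ((u.map some).reverse ++ L) []) (w ++ u) := by
  induction u with
  | nil => intro L w; simp
  | cons b u ih =>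
    intro L w
    have := step_prep (M := M) (P := P) (O := O) (q := .inl .scan) (q' := .inl .scan)
      (t := Turing.Tape.mk₂ L ((b :: u).map some)) (w := w) (a := some b) (e := some b)
      (d := .right) (by simp [control, prepHeads, mk₂_head_cons])
    rw [List.length_cons, Function.iterate_succ_apply, this, List.map_cons, mk₂_write_cons,
      mk₂_move_right_cons, ih]
    simp

theorem iterate_back (O : ι' → Language Bool) (b : Bool) (w : List Bool) (L : List Bool) :
    ∀ R : List (Option Bool), ((M.control P).step O)^[L.length + 1]
        (prep P (.inl (.back b)) ((Turing.Tape.mk₂ (L.map some) R).move .left) w) =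
      prep P (.inr (M.start, P.start b)) (Turing.Tape.mk₂ [] ((L.map some).reverse ++ R)) w := by
  induction L with
  | nil =>
    intro R
    have := step_prep (M := M) (P := P) (O := O) (q := .inl (.back b))
      (q' := .inr (M.start, P.start b))
      (t := (Turing.Tape.mk₂ [] R).move .left) (w := w) (a := none) (e := none)
      (d := .right) (by simp [control, prepHeads, mk₂_move_left_nil_head])
    simp only [List.length_nil, List.map_nil, Function.iterate_one, zero_add, this]
    rw [write_move_of_head (mk₂_move_left_nil_head R)]
    simp
  | cons a L ih =>
    intro R
    have := step_prep (M := M) (P := P) (O := O) (q := .inl (.back b)) (q' := .inl (.back b))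
      (t := Turing.Tape.mk₂ (L.map some) (some a :: R)) (w := w) (a := some a) (e := none)
      (d := .left) (by simp [control, prepHeads, mk₂_head_cons])
    rw [List.length_cons, Function.iterate_succ_apply, List.map_cons, mk₂_move_left_cons, this,
      mk₂_write_cons, Option.toList_none, List.append_nil, ih]
    simp

/-- With `n` letters: `n` steps to scan, one to step back from the blank, one at the last letter,
and `n` to return to the first letter. -/
theorem iterate_init (O : ι' → Language Bool) (w : List Bool) :
    ((M.control P).step O)^[2 * w.length + 2] ((M.control P).init w) =
      prep P (.inr (M.start, P.start (w.getLast?.getD false)))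
        (Turing.Tape.mk₁ ((P.input w).map some)) w := by
  have h0 : (M.control P).init w = prep P (.inl .scan) (Turing.Tape.mk₂ [] (w.map some)) [] := by
    simp only [init, prep, control, Turing.Tape.mk₁, ite_self]
    rfl
  have h1 := iterate_scan (M := M) (P := P) O w [] []
  rw [← h0, List.nil_append, List.append_nil] at h1
  have h2 := step_prep (M := M) (P := P) (O := O) (q := .inl .scan) (q' := .inl .turn)
      (t := Turing.Tape.mk₂ (w.map some).reverse []) (w := w) (a := none) (e := none)
      (d := .left) (by simp [control, prepHeads, mk₂_head_nil])
  rw [write_move_of_head (mk₂_head_nil _), Option.toList_none, List.append_nil] at h2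
  -- In the state `turn` the head sees a blank exactly when the input is empty.
  rcases List.eq_nil_or_concat' w with rfl | ⟨y, b, rfl⟩
  · have h3 := step_prep (M := M) (P := P) (O := O) (q := .inl .turn)
      (q' := .inr (M.start, P.start false))
      (t := (Turing.Tape.mk₂ [] []).move .left) (w := []) (a := none) (e := none)
      (d := .right) (by simp [control, prepHeads, mk₂_move_left_nil_head])
    rw [write_move_of_head (mk₂_move_left_nil_head _)] at h3
    simp only [List.length_nil, Function.iterate_zero, id_eq] at h1
    rw [show 2 * ([] : List Bool).length + 2 = 1 + 1 from rfl, Function.iterate_add_apply, h1]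
    simp only [List.map_nil, List.reverse_nil] at h2
    simp only [Function.iterate_one, h2, List.map_nil, List.reverse_nil, h3]
    simp [Controller.input, Turing.Tape.mk₁]
  · have h3 := step_prep (M := M) (P := P) (O := O) (q := .inl .turn)
      (q' := .inl (.back b))
      (t := Turing.Tape.mk₂ (y.map some).reverse [some b]) (w := y ++ [b])
      (a := if P.strip then none else some b) (e := none)
      (d := .left) (by
        simp only [control, prepHeads, mk₂_head_cons, ite_self, if_true]
        congr 1
        funext i
        split_ifs <;> simp_all [prepHeads])
    rw [mk₂_write_cons, Option.toList_none, List.append_nil] at h3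
    have h4 := iterate_back (M := M) (P := P) O b (y ++ [b]) y.reverse
      [if P.strip then none else some b]
    rw [List.map_reverse, ← h3, List.reverse_reverse] at h4
    have h2' : (Turing.Tape.mk₂ ((y ++ [b]).map some).reverse []).move .left =
        Turing.Tape.mk₂ (y.map some).reverse [some b] := by
      simp [mk₂_move_left_cons]
    rw [h2'] at h2
    rw [show 2 * (y ++ [b]).length + 2 = (y.reverse.length + 1) + 1 + 1 + (y ++ [b]).length by
      simp; ring, Function.iterate_add_apply, h1, Function.iterate_add_apply,
      Function.iterate_add_apply, Function.iterate_one, h2, h4]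
    congr 1
    · simp; rfl
    · cases hs : P.strip
      · simp [Controller.input, Turing.Tape.mk₁, hs]
      · simp [Controller.input, hs, mk₂_append_none]

theorem yields_init {w : List Bool} {T : ℕ} {v : Bool} {o : List Bool} {l : List (Finset ι')}
    {X : ι' → List Bool} {Y : List Bool}
    (hX : ∀ j, (P.source (P.start (w.getLast?.getD false)) j).elim (X j) (fun _ => []) =
      if P.copyQuery j then w else [])
    (hY : (P.outSource (P.start (w.getLast?.getD false))).elim Y (fun _ => []) =
      if P.copyOut then w else [])
    (h : (M.control P).Yields O (conf P (P.start (w.getLast?.getD false)) (M.init (P.input w))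
      X Y []) T v o l) :
    (M.control P).Yields O ((M.control P).init w) (T + (2 * w.length + 2)) v o l := by
  refine Yields.of_iterate ?_ h
  rw [iterate_init]
  simp only [prep, conf, init, hX, hY]

end OracleTM

end QueryOrder

/-! ### Commands at pauses, time bounds, and the inner reduction. -/

namespace QueryOrder

namespace OracleTM
section

variable {ι ι' K : Type} [DecidableEq ι] [DecidableEq ι'] [Finite K] {M : OracleTM ι}
  {P : Controller ι ι' K} {E : ι → Bool} {T : ℕ} {k : K} {c : M.Cfg}

theorem HaltsIn.commands (h : M.HaltsIn E T c) {m : Command ι ι' K}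
    (hA : ∀ S, M.asks (M.pause c) = some S → P.onAsk k S = m)
    (hH : ∀ v, M.verdict (M.pause c) = some v → P.onHalt k v = m) :
    Commands P k (M.pause c) m := by
  rcases h.verdict_or_asks with ⟨v, hv⟩ | ⟨S, hS⟩
  · exact .inr ⟨v, hv, hH v hv⟩
  · exact .inl ⟨S, hS, hA S hS⟩

/-- Since `final` is `false` at a query, a controller must treat a surplus query like the verdict
`false`. All controllers use this default, so their values on illegitimate branches agree. -/
theorem HaltsIn.commands_final (h : M.HaltsIn E T c) {g : Bool → Command ι ι' K}
    (hA : ∀ S, M.asks (M.pause c) = some S → P.onAsk k S = g false)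
    (hH : ∀ v, P.onHalt k v = g v) :
    Commands P k (M.pause c) (g (M.final c)) := by
  refine h.commands (fun S hS => ?_) fun v hv => ?_
  · rw [hA S hS, final, verdict_of_asks hS]
    rfl
  · rw [hH, final_eq hv]

theorem polyTime_of_yields {M : OracleTM ι} (p : Polynomial ℕ)
    (h : ∀ O x, ∃ v o l, M.Yields O (M.init x) (p.eval x.length) v o l) : M.PolyTime := by
  refine ⟨p, fun O x => ?_⟩
  obtain ⟨v, o, l, t, ht, hv, -⟩ := h O x
  exact ⟨t, ht, v, hv⟩

end

variable {ι : Type} [DecidableEq ι]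

/-! ### The inner reduction: appending the answer of `D` -/

inductive AppendState where
  | start
  | afterC
  | first (a : Bool)
  | second (a : Bool)
  | fin
  | done
  deriving Fintype

/-- Copies the input to the output and appends one bit. If the controlled machine first asks the
oracle `i`, then this bit is its verdict when the answer of `i` is negative; if it first asks
`j`, then this bit is the answer of `j`. -/
def appendBit (i j : ι) : Controller ι (Fin 1) AppendState where
  strip := false
  copyQuery _ := false
  copyOut := true
  start _ := .start
  source
    -- The query to `j` may be partly written before `i` is asked, so its tape is recorded from the
    -- beginning.
    | .start, _ => some j
    | .afterC, _ => some j
    | _, _ => none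
  outSource _ := none
  onAsk
    | .start, S =>
      if S = {i} then .feed (single i false) .afterC
      else if S = {j} then .query {0} fun r => .first (r 0)
      else .emit false .done
    | .afterC, S => if S = {j} then .query {0} fun r => .second (r 0) else .emit false .done
    | .first a, _ => .emit a .done
    | .second a, _ => .feed (single j a) .fin
    | .fin, _ => .emit false .done
    | .done, _ => .halt true
  onHalt
    | .start, _ => .emit false .done
    | .afterC, v => .emit v .done
    | .fin, v => .emit v .done
    | _, _ => .halt true

open Classical in
-- The information about `D` that the outer reduction needs beyond its own single query.
noncomputable def appendedBit (M : OracleTM ι) (i j : ι) (D : Language Bool) (x : List Bool) :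
    Bool :=
  let s := M.pause (M.init x)
  if M.asks s = some {i} then M.finalAfterQuery j D (M.reply s (single i false))
  else if M.asks s = some {j} then decide (s.query j ∈ D)
  else false

variable {M : OracleTM ι} {i j : ι} {E : ι → Bool} {O : Fin 1 → Language Bool} {T : ℕ}
  {X : Fin 1 → List Bool} {Y : List Bool} {l : List (Finset (Fin 1))} {c : M.Cfg} {x : List Bool}

theorem appendBit_emit {k : AppendState} {b : Bool} (h : M.HaltsIn E T c)
    (hc : Commands (appendBit i j) k (M.pause c) (.emit b .done)) :
    (M.control (appendBit i j)).Yields O (conf (appendBit i j) k (M.pause c) X Y l) 1 true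
      (Y ++ [b]) l :=
  yields_conf_emit hc (fun _ => rfl) rfl
    (yields_conf_halt (h.commands (fun _ _ => rfl) fun _ _ => rfl) rfl)

theorem appendBit_fin (h : M.HaltsIn E T c) :
    (M.control (appendBit i j)).Yields O (conf (appendBit i j) .fin c X Y l) (T + 1) true
      (Y ++ [M.final c]) l := by
  have hc : Commands (appendBit i j) .fin (M.pause c) (.emit (M.final c) .done) :=
    h.commands_final (g := fun v => .emit v AppendState.done) (fun _ _ => rfl) fun _ => rfl
  refine Yields.mono (yields_conf_pause (appendBit_emit h hc)) ?_
  have := h.pauseTime_le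
  omega

/-- The answer of `i` is already fixed as `e` while that of `j` is open, so halting is assumed for
all constant answers that agree with `e` at `i`. -/
theorem appendBit_afterC {e : Bool} (hij : j ≠ i) (h : ∀ E, E i = e → M.HaltsIn E T c) :
    ∃ l', l'.length ≤ l.length + 1 ∧
    (M.control (appendBit i j)).Yields O (conf (appendBit i j) .afterC c X Y l) (T + 4) true
      (Y ++ [M.finalAfterQuery j (O 0) c]) l' := by
  classical
  have h0 := h (fun _ => e) rfl
  have hT := h0.pauseTime_le
  by_cases hs : M.asks (M.pause c) = some {j}
  · refine ⟨l ++ [{0}], by simp, ?_⟩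
    set a : Bool := decide ((M.pause c).query j ∈ O 0) with ha
    -- The true answer of `j` is built into the constant oracles; as `j ≠ i`, the answer of `i` is
    -- unaffected.
    have h1 := (h (Function.update (fun _ => e) j a) (by simp [hij.symm])).pause
    have hpos := h1.pos hs
    have h2 := h1.reply_singleton hs
    simp only [Function.update_self] at h2
    rw [finalAfterQuery, if_pos hs]
    refine Yields.mono (yields_conf_pause (yields_conf_query (S := {0}) (a := single 0 a)
      (g := fun r => .second (r 0)) (X' := fun _ => []) (Y' := Y) (.inl ⟨_, hs, by simp [appendBit]⟩)
      (answers_singleton _ _ _) (fun j' => ?_) rfl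
      (yields_conf_feed hs rfl (fun _ => rfl) rfl (appendBit_fin h2)))) (by omega)
    simp [appendBit, Subsingleton.elim j' 0]
  · refine ⟨l, by simp, ?_⟩
    rw [finalAfterQuery, if_neg hs]
    have hc : Commands (appendBit i j) .afterC (M.pause c) (.emit (M.final c) .done) :=
      h0.commands_final (g := fun v => .emit v AppendState.done)
        (fun S hS => if_neg fun hSj : S = {j} => hs (hSj ▸ hS)) fun _ => rfl
    exact Yields.mono (yields_conf_pause (appendBit_emit h0 hc)) (by omega)

theorem appendBit_start (hij : j ≠ i) (h : ∀ E, M.HaltsIn E T (M.init x)) :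
    ∃ l', l'.length ≤ l.length + 1 ∧
    (M.control (appendBit i j)).Yields O (conf (appendBit i j) .start (M.init x) X Y l) (T + 6) true
      (Y ++ [M.appendedBit i j (O 0) x]) l' := by
  classical
  have hT := (h fun _ => false).pauseTime_le
  unfold appendedBit
  by_cases hi : M.asks (M.pause (M.init x)) = some {i}
  · have h1 : ∀ E : ι → Bool, E i = false → M.HaltsIn E (T - M.pauseTime (M.init x) - 1)
        (M.reply (M.pause (M.init x)) (single i false)) := fun E hE =>
      hE ▸ (h E).pause.reply_singleton hi
    have hpos := (h fun _ => false).pause.pos hi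
    obtain ⟨l', hl', hy⟩ := appendBit_afterC (O := O) (X := X) (Y := Y) (l := l) hij h1
    refine ⟨l', hl', ?_⟩
    simp only [hi, if_true]
    refine Yields.mono (yields_conf_pause (yields_conf_feed hi (by simp [appendBit]) (fun _ => ?_) rfl
      hy)) (by omega)
    simp [appendBit, M.reply_query hi, hij]
  · by_cases hj : M.asks (M.pause (M.init x)) = some {j}
    · refine ⟨l ++ [{0}], by simp, ?_⟩
      rw [if_neg hi, if_pos hj]
      refine Yields.mono (yields_conf_pause (yields_conf_query (S := {0}) (g := fun r => .first (r 0))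
        (X' := fun _ => []) (Y' := Y) (.inl ⟨_, hj, by simp [appendBit, hij]⟩)
        (answers_singleton _ _ _) (fun j' => ?_) rfl
        (appendBit_emit (h fun _ => false) (.inl ⟨_, hj, ?_⟩)))) (by omega)
      · simp [appendBit, Subsingleton.elim j' 0]
      · rfl
    · refine ⟨l, by simp, ?_⟩
      rw [if_neg hi, if_neg hj]
      refine Yields.mono (yields_conf_pause (appendBit_emit (h fun _ => false)
        ((h fun _ => false).commands (fun S hS => ?_) fun _ _ => rfl))) (by omega)
      have h1 : S ≠ {i} := fun h => hi (h ▸ hS)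
      have h2 : S ≠ {j} := fun h => hj (h ▸ hS)
      simp [appendBit, h1, h2]

theorem appendBit_init (hij : j ≠ i) {x : List Bool} (h : ∀ E, M.HaltsIn E T (M.init x)) :
    ∃ l' : List (Finset (Fin 1)), l'.length ≤ 1 ∧
    (M.control (appendBit i j)).Yields O ((M.control (appendBit i j)).init x)
      (T + 6 + (2 * x.length + 2)) true (x ++ [M.appendedBit i j (O 0) x]) l' := by
  obtain ⟨l', hl', hy⟩ := appendBit_start (O := O) (X := fun _ => []) (Y := x) (l := []) hij h
  exact ⟨l', hl', yields_init (fun _ => rfl) rfl hy⟩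

end OracleTM

end QueryOrder

namespace QueryOrder

namespace OracleTM
variable {ι : Type} [DecidableEq ι]

/-! ### The outer reduction: the query to `C` -/

inductive ReduceState where
  | start (b : Bool)
  | afterC (b : Bool)
  | afterD
  | second (b a : Bool)
  | fin (b : Bool)
  | done
  deriving Fintype

/-- Removes the last bit `b` of the input and outputs the query of the controlled machine to the
oracle `i`, followed by one bit. If this query comes first, then the bit tells whether `b` is the
verdict when the answer is positive; if it is preceded by a query to `j`, then `b` is used as the
answer of `j`, and the bit is `0`. -/
def reduceQuery (i j : ι) : Controller ι (Fin 1) ReduceState where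
  strip := true
  copyQuery _ := false
  copyOut := false
  start b := .start b
  source
    | .start _, _ => some j
    | .afterC _, _ => some j
    | _, _ => none
  outSource
    | .start _ => some i
    | .afterD => some i
    | _ => none
  onAsk
    | .start b, S =>
      if S = {i} then .feed (single i true) (.afterC b)
      else if S = {j} then .feed (single j b) .afterD
      -- A final bit `1` puts the output outside `C ⊕ ∅`.
      else .emit true .done
    | .afterC b, S =>
      -- A surplus query counts as the verdict `false`, in agreement with `finalAfterQuery`.
      if S = {j} then .query {0} fun r => .second b (r 0) else .emit (false == b) .done
    | .afterD, S => .emit (decide (S ≠ {i})) .done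
    | .second b a, _ => .feed (single j a) (.fin b)
    | .fin b, _ => .emit (false == b) .done
    | .done, _ => .halt true
  onHalt
    | .start _, _ => .emit true .done
    | .afterC b, v => .emit (v == b) .done
    | .afterD, _ => .emit true .done
    | .fin b, v => .emit (v == b) .done
    | _, _ => .halt true

variable {M : OracleTM ι} {i j : ι} {E : ι → Bool} {O : Fin 1 → Language Bool} {T : ℕ}
  {X : Fin 1 → List Bool} {Y : List Bool} {l : List (Finset (Fin 1))} {c : M.Cfg} {x : List Bool}
  {b : Bool}

theorem reduceQuery_emit {k : ReduceState} {v : Bool} (h : M.HaltsIn E T c)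
    (hc : Commands (reduceQuery i j) k (M.pause c) (.emit v .done)) :
    (M.control (reduceQuery i j)).Yields O (conf (reduceQuery i j) k (M.pause c) X Y l) 1 true
      (((reduceQuery i j).outSource k).elim Y (M.pause c).query ++ [v]) l :=
  yields_conf_emit hc (fun _ => rfl) rfl
    (yields_conf_halt (h.commands (fun _ _ => rfl) fun _ _ => rfl) rfl)

theorem reduceQuery_fin (h : M.HaltsIn E T c) :
    (M.control (reduceQuery i j)).Yields O (conf (reduceQuery i j) (.fin b) c X Y l) (T + 1) true
      (Y ++ [M.final c == b]) l := by
  have hc : Commands (reduceQuery i j) (.fin b) (M.pause c) (.emit (M.final c == b) .done) :=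
    h.commands_final (g := fun v => .emit (v == b) ReduceState.done) (fun _ _ => rfl) fun _ => rfl
  refine Yields.mono (yields_conf_pause (reduceQuery_emit h hc)) ?_
  have := h.pauseTime_le
  omega

theorem reduceQuery_afterC {e : Bool} (hij : j ≠ i) (h : ∀ E, E i = e → M.HaltsIn E T c) :
    ∃ l', l'.length ≤ l.length + 1 ∧
    (M.control (reduceQuery i j)).Yields O (conf (reduceQuery i j) (.afterC b) c X Y l) (T + 4) true
      (Y ++ [M.finalAfterQuery j (O 0) c == b]) l' := by
  classical
  have h0 := h (fun _ => e) rfl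
  have hT := h0.pauseTime_le
  by_cases hs : M.asks (M.pause c) = some {j}
  · refine ⟨l ++ [{0}], by simp, ?_⟩
    set a : Bool := decide ((M.pause c).query j ∈ O 0) with ha
    have h1 := (h (Function.update (fun _ => e) j a) (by simp [hij.symm])).pause
    have hpos := h1.pos hs
    have h2 := h1.reply_singleton hs
    simp only [Function.update_self] at h2
    rw [finalAfterQuery, if_pos hs]
    refine Yields.mono (yields_conf_pause (yields_conf_query (S := {0}) (a := single 0 a)
      (g := fun r => .second b (r 0)) (X' := fun _ => []) (Y' := Y)
      (.inl ⟨_, hs, by simp [reduceQuery]⟩) (answers_singleton _ _ _) (fun j' => ?_) rfl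
      (yields_conf_feed hs rfl (fun _ => rfl) rfl (reduceQuery_fin h2)))) (by omega)
    simp [reduceQuery, Subsingleton.elim j' 0]
  · refine ⟨l, by simp, ?_⟩
    rw [finalAfterQuery, if_neg hs]
    have hc : Commands (reduceQuery i j) (.afterC b) (M.pause c) (.emit (M.final c == b) .done) :=
      h0.commands_final (g := fun v => .emit (v == b) ReduceState.done)
        (fun S hS => if_neg fun hSj : S = {j} => hs (hSj ▸ hS)) fun _ => rfl
    exact Yields.mono (yields_conf_pause (reduceQuery_emit h0 hc)) (by omega)

/-- When `b` is the verdict of the negative branch, the last bit is `0` exactly if the answer of `i`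
affects the verdict. -/
theorem reduceQuery_start_of_asks_left (hij : j ≠ i) (h : ∀ E, M.HaltsIn E T c)
    (hi : M.asks (M.pause c) = some {i}) :
    ∃ l', l'.length ≤ l.length + 1 ∧
    (M.control (reduceQuery i j)).Yields O (conf (reduceQuery i j) (.start b) c X Y l)
      (T + 6) true ((M.pause c).query i ++
        [M.finalAfterQuery j (O 0) (M.reply (M.pause c) (single i true)) == b]) l' := by
  have hT := (h fun _ => false).pauseTime_le
  have h1 : ∀ E : ι → Bool, E i = true → M.HaltsIn E (T - M.pauseTime c - 1)
      (M.reply (M.pause c) (single i true)) := fun E hE => hE ▸ (h E).pause.reply_singleton hi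
  have hpos := (h fun _ => false).pause.pos hi
  -- Asking erases the query tape of `M`, but the copy on the output tape stays; from here on `Y`
  -- describes it.
  obtain ⟨l', hl', hy⟩ := reduceQuery_afterC (O := O) (X := X) (Y := (M.pause c).query i) (l := l)
    (b := b) hij h1
  refine ⟨l', hl', ?_⟩
  refine Yields.mono (yields_conf_pause (yields_conf_feed hi (by simp [reduceQuery])
    (fun _ => ?_) rfl hy)) (by omega)
  simp [reduceQuery, M.reply_query hi, hij]

/-- The bit `b` replaces the answer of `j`, so no query is made and the log stays `l`. The last bit
is `0` exactly if `i` is then really asked. -/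
theorem reduceQuery_start_of_asks_right (hij : j ≠ i) (h : ∀ E, M.HaltsIn E T c)
    (hj : M.asks (M.pause c) = some {j}) :
    (M.control (reduceQuery i j)).Yields O (conf (reduceQuery i j) (.start b) c X Y l)
      (T + 6) true ((M.pause (M.reply (M.pause c) (single j b))).query i ++
        [decide (M.asks (M.pause (M.reply (M.pause c) (single j b))) ≠ some {i})]) l := by
  have hT := (h fun _ => false).pauseTime_le
  have h1 : M.HaltsIn (fun _ => b) (T - M.pauseTime c - 1)
      (M.reply (M.pause c) (single j b)) := (h fun _ => b).pause.reply_singleton hj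
  have hpos := (h fun _ => false).pause.pos hj
  have hT' := h1.pauseTime_le
  refine Yields.mono (yields_conf_pause (yields_conf_feed (X' := fun _ => (M.pause c).query j)
    (k' := .afterD) (a := single j b) (Y' := Y) hj (by simp [reduceQuery, hij])
    (fun _ => rfl) ?_ (yields_conf_pause (reduceQuery_emit h1 (h1.commands ?_ ?_))))) (by omega)
  · simp [reduceQuery, M.reply_query hj, hij.symm]
  · intro S hS
    simp [reduceQuery, hS]
  · intro v hv
    simp [reduceQuery, asks_of_verdict hv]

/-- Some output always appears in time; this makes the reduction total where its value is
irrelevant. -/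
theorem reduceQuery_start (hij : j ≠ i) (h : ∀ E, M.HaltsIn E T c) :
    ∃ o l', l'.length ≤ l.length + 1 ∧
    (M.control (reduceQuery i j)).Yields O (conf (reduceQuery i j) (.start b) c X Y l)
      (T + 6) true o l' := by
  by_cases hi : M.asks (M.pause c) = some {i}
  · exact ⟨_, reduceQuery_start_of_asks_left hij h hi⟩
  · by_cases hj : M.asks (M.pause c) = some {j}
    · exact ⟨_, l, by simp, reduceQuery_start_of_asks_right hij h hj⟩
    · have hT := (h fun _ => false).pauseTime_le
      refine ⟨_, l, by simp, Yields.mono (yields_conf_pause (reduceQuery_emit (h fun _ => false)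
        (v := true) ((h fun _ => false).commands (fun S hS => ?_) fun _ _ => rfl))) (by omega)⟩
      have h1 : S ≠ {i} := fun h => hi (h ▸ hS)
      have h2 : S ≠ {j} := fun h => hj (h ▸ hS)
      simp [reduceQuery, h1, h2]

/-- A computation of the controlled machine extends to one from the initial configuration. -/
theorem reduceQuery_init {w : List Bool} {o : List Bool}
    (h : (M.control (reduceQuery i j)).Yields O (conf (reduceQuery i j)
      (.start (w.getLast?.getD false)) (M.init w.dropLast) (fun _ => []) [] []) T true o l) :
    (M.control (reduceQuery i j)).Yields O ((M.control (reduceQuery i j)).init w)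
      (T + (2 * w.length + 2)) true o l :=
  yields_init (fun _ => rfl) rfl h

/-! ### The machine with simultaneous queries -/

inductive CombineState where
  | start
  | afterC
  | second (g a : Bool)
  | first (g a : Bool)
  | afterD (g : Bool)
  | fin (g : Bool)
  deriving Fintype

/-- Asks the oracle `0` about the input, together with the query that the controlled machine asks
the oracle `j`, possibly after a negative answer of the oracle `i`. -/
def combine (i j : ι) : Controller ι (Fin 2) CombineState where
  strip := false
  copyQuery o := decide (o = 0)
  copyOut := false
  start _ := .start
  source
    | .start, o => if o = 1 then some j else none
    | .afterC, o => if o = 1 then some j else none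
    | _, _ => none
  outSource _ := none
  onAsk
    | .start, S =>
      if S = {i} then .feed (single i false) .afterC
      else if S = {j} then .query Finset.univ fun r => .first (r 0) (r 1)
      else .halt false
    | .afterC, S =>
      if S = {j} then .query Finset.univ fun r => .second (r 0) (r 1)
      -- Even if the negative branch does not ask `j`, the bit of `G` is needed to correct its
      -- verdict.
      else .query {0} fun r => .fin (r 0)
    | .second g a, _ => .feed (single j a) (.fin g)
    | .first g a, _ => .feed (single j a) (.afterD g)
    | .afterD g, S => if S = {i} then .feed (single i g) (.fin false) else .halt false
    | .fin g, _ => .halt (xor false g)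
  onHalt
    | .start, v => .halt v
    | .afterC, _ => .query {0} fun r => .fin (r 0)
    | .afterD _, v => .halt v
    | .fin g, v => .halt (xor v g)
    | _, _ => .halt false

variable {O : Fin 2 → Language Bool} {X : Fin 2 → List Bool} {l : List (Finset (Fin 2))} {g : Bool}

theorem combine_fin (h : M.HaltsIn E T c) :
    (M.control (combine i j)).Yields O (conf (combine i j) (.fin g) c X Y l) T
      (xor (M.final c) g) Y l := by
  have hc : Commands (combine i j) (.fin g) (M.pause c) (.halt (xor (M.final c) g)) :=
    h.commands_final (g := fun v => .halt (xor v g)) (fun _ _ => rfl) fun _ => rfl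
  refine Yields.mono (yields_conf_pause (yields_conf_halt (T := 0) hc rfl)) ?_
  have := h.pauseTime_le
  omega

open Classical in
/-- The two simultaneous queries of `combine`. -/
theorem combine_query {k : CombineState} {K : Bool → Bool → CombineState} {v : Bool}
    (hk : (combine i j).source k = fun o => if o = 1 then some j else none)
    (hc : Commands (combine i j) k c (.query Finset.univ fun r => K (r 0) (r 1)))
    (hy : (M.control (combine i j)).Yields O
      (conf (combine i j) (K (decide (X 0 ∈ O 0)) (decide (c.query j ∈ O 1))) c
        (fun _ => []) Y (l ++ [Finset.univ])) T v Y (l ++ [Finset.univ]))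
    (hK : (combine i j).source (K (decide (X 0 ∈ O 0)) (decide (c.query j ∈ O 1))) =
      fun _ => none) :
    (M.control (combine i j)).Yields O (conf (combine i j) k c X Y l) (T + 1) v Y
      (l ++ [Finset.univ]) := by
  refine yields_conf_query (a := ![decide (X 0 ∈ O 0), decide (c.query j ∈ O 1)]) hc ?_ ?_ rfl hy
  · funext o
    rw [hk]
    fin_cases o <;> simp [answers]
  · intro o
    simp [hK]

-- The negative branch does not depend on the bit of oracle `0`, which only flips its verdict; hence
-- both oracles can be asked at once.
open Classical in
theorem combine_afterC {e : Bool} (hij : j ≠ i) (h : ∀ E, E i = e → M.HaltsIn E T c) :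
    ∃ S, (M.control (combine i j)).Yields O (conf (combine i j) .afterC c X Y l) (T + 4)
      (xor (M.finalAfterQuery j (O 1) c) (decide (X 0 ∈ O 0))) Y (l ++ [S]) := by
  have h0 := h (fun _ => e) rfl
  have hT := h0.pauseTime_le
  by_cases hs : M.asks (M.pause c) = some {j}
  · refine ⟨Finset.univ, ?_⟩
    have h1 := (h (Function.update (fun _ => e) j (decide ((M.pause c).query j ∈ O 1)))
      (by simp [hij.symm])).pause
    have hpos := h1.pos hs
    have h2 := h1.reply_singleton hs
    rw [Function.update_self] at h2
    rw [finalAfterQuery, if_pos hs]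
    exact Yields.mono (yields_conf_pause (combine_query rfl (.inl ⟨_, hs, if_pos rfl⟩)
      (yields_conf_feed hs rfl (fun _ => rfl) rfl (combine_fin h2)) rfl)) (by omega)
  · refine ⟨{0}, ?_⟩
    rw [finalAfterQuery, if_neg hs]
    have hc : Commands (combine i j) .afterC (M.pause c) (.query {0} fun r => .fin (r 0)) :=
      h0.commands
        (fun S hS => if_neg fun hSj : S = {j} => hs (hSj ▸ hS)) fun _ _ => rfl
    have hf : Commands (combine i j) (.fin (decide (X 0 ∈ O 0))) (M.pause c)
        (.halt (xor (M.final c) (decide (X 0 ∈ O 0)))) :=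
      h0.commands_final (g := fun v => .halt (xor v _)) (fun _ _ => rfl) fun _ => rfl
    exact Yields.mono (yields_conf_pause (yields_conf_query (Y' := Y)
      (a := single 0 (decide (X 0 ∈ O 0))) hc (answers_singleton _ _ _)
      (fun _ => rfl) rfl (yields_conf_halt (T := 0) hf rfl))) (by omega)

theorem combine_afterD {e : Bool} (hij : j ≠ i) (h : ∀ E, E j = e → M.HaltsIn E T c) :
    (M.control (combine i j)).Yields O (conf (combine i j) (.afterD g) c X Y l) (T + 1)
      (if M.asks (M.pause c) = some {i} then M.final (M.reply (M.pause c) (single i g))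
        else M.final c) Y l := by
  have h0 := h (fun _ => e) rfl
  have hT := h0.pauseTime_le
  by_cases hs : M.asks (M.pause c) = some {i}
  · have h1 := (h (Function.update (fun _ => e) i g) (by simp [hij])).pause
    have hpos := h1.pos hs
    have h2 := h1.reply_singleton hs
    rw [Function.update_self] at h2
    -- When `j` came first, `g` has been fed as the answer of `i` and must not flip the verdict as
    -- well.
    have h3 := combine_fin (i := i) (j := j) (O := O) (X := X) (Y := Y) (l := l) (g := false) h2
    rw [Bool.xor_false] at h3
    rw [if_pos hs]
    exact Yields.mono (yields_conf_pause (yields_conf_feed hs (if_pos rfl) (fun _ => rfl) rfl h3))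
      (by omega)
  · rw [if_neg hs]
    have hc : Commands (combine i j) (.afterD g) (M.pause c) (.halt (M.final c)) :=
      h0.commands_final (g := fun v => .halt v)
        (fun S hS => if_neg fun hSj : S = {i} => hs (hSj ▸ hS)) fun _ => rfl
    exact Yields.mono (yields_conf_pause (yields_conf_halt (T := 0) hc rfl)) (by omega)

open Classical in
/-- The verdict of `M.control (combine i j)` with oracles `G` and `D`. -/
noncomputable def combinedVerdict (M : OracleTM ι) (i j : ι) (G D : Language Bool)
    (x : List Bool) : Bool :=
  let s := M.pause (M.init x)
  let g := decide (x ∈ G)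
  if M.asks s = some {i} then xor (M.finalAfterQuery j D (M.reply s (single i false))) g
  else if M.asks s = some {j} then
    let c := M.reply s (single j (decide (s.query j ∈ D)))
    if M.asks (M.pause c) = some {i} then M.final (M.reply (M.pause c) (single i g)) else M.final c
  else M.final (M.init x)

theorem combine_start (hij : j ≠ i) (h : ∀ E, M.HaltsIn E T (M.init x)) (hX : X 0 = x) :
    ∃ l', l'.length ≤ l.length + 1 ∧
    (M.control (combine i j)).Yields O (conf (combine i j) .start (M.init x) X Y l) (T + 6)
      (M.combinedVerdict i j (O 0) (O 1) x) Y l' := by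
  classical
  subst hX
  have hT := (h fun _ => false).pauseTime_le
  unfold combinedVerdict
  by_cases hi : M.asks (M.pause (M.init (X 0))) = some {i}
  · have h1 : ∀ E : ι → Bool, E i = false → M.HaltsIn E (T - M.pauseTime (M.init (X 0)) - 1)
        (M.reply (M.pause (M.init (X 0))) (single i false)) := fun E hE =>
      hE ▸ (h E).pause.reply_singleton hi
    have hpos := (h fun _ => false).pause.pos hi
    obtain ⟨S, hy⟩ := combine_afterC (O := O) (X := X) (Y := Y) (l := l) hij h1
    refine ⟨l ++ [S], by simp, ?_⟩
    simp only [hi, if_true]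
    refine Yields.mono (yields_conf_pause (yields_conf_feed hi (if_pos rfl) (fun o => ?_) rfl
      hy)) (by omega)
    by_cases ho : o = 1 <;> simp [combine, ho, M.reply_query hi, hij]
  · by_cases hj : M.asks (M.pause (M.init (X 0))) = some {j}
    · refine ⟨l ++ [Finset.univ], by simp, ?_⟩
      rw [if_neg hi, if_pos hj]
      have h1 : ∀ E : ι → Bool, E j = decide ((M.pause (M.init (X 0))).query j ∈ O 1) →
          M.HaltsIn E (T - M.pauseTime (M.init (X 0)) - 1) (M.reply (M.pause (M.init (X 0)))
            (single j (decide ((M.pause (M.init (X 0))).query j ∈ O 1)))) := fun E hE =>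
        hE ▸ (h E).pause.reply_singleton hj
      have hpos := (h fun _ => false).pause.pos hj
      refine Yields.mono (yields_conf_pause (combine_query (K := .first) rfl
        (.inl ⟨_, hj, ?_⟩)
        (yields_conf_feed hj rfl (fun _ => rfl) rfl (combine_afterD hij h1)) rfl)) ?_
      · simp [combine, hij]
      · omega
    · refine ⟨l, by simp, ?_⟩
      rw [if_neg hi, if_neg hj]
      have hc : Commands (combine i j) .start (M.pause (M.init (X 0)))
          (.halt (M.final (M.init (X 0)))) := by
        refine (h fun _ => false).commands_final (g := fun v => .halt v) (fun S hS => ?_)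
          fun _ => rfl
        have h1 : S ≠ {i} := fun h => hi (h ▸ hS)
        have h2 : S ≠ {j} := fun h => hj (h ▸ hS)
        simp [combine, h1, h2]
      exact Yields.mono (yields_conf_pause (yields_conf_halt (T := 0) hc rfl)) (by omega)

theorem combine_init (hij : j ≠ i) (h : ∀ E, M.HaltsIn E T (M.init x)) :
    ∃ l' : List (Finset (Fin 2)), l'.length ≤ 1 ∧
    (M.control (combine i j)).Yields O ((M.control (combine i j)).init x)
      (T + 6 + (2 * x.length + 2)) (M.combinedVerdict i j (O 0) (O 1) x) [] l' := by
  obtain ⟨l', hl', hy⟩ := combine_start (O := O) (X := ![x, []]) (Y := []) (l := []) hij h rfl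
  refine ⟨l', hl', yields_init (fun o => ?_) rfl hy⟩
  fin_cases o <;> simp [combine]

end OracleTM

end QueryOrder

namespace QueryOrder

namespace OracleTM
/-! ### Asking one oracle after the other -/

inductive SequentialState where
  | start
  | half (e : Bool)
  | got (e e' : Bool)
  | fin
  deriving Fintype

/-- Replaces a simultaneous query to `i` and `j` by a query to `0` followed by a query to `1`. -/
def sequential (i j : Fin 2) : Controller (Fin 2) (Fin 2) SequentialState where
  strip := false
  copyQuery _ := false
  copyOut := false
  start _ := .start
  source
    | .start, o => some (if o = 0 then i else j)
    | .half _, o => if o = 1 then some j else none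
    | _, _ => none
  outSource _ := none
  onAsk
    | .start, S =>
      if i ∈ S then .query {0} fun r => .half (r 0)
      -- `false` is what `answers` gives for the oracle `i`, which is not asked.
      else if j ∈ S then .query {1} fun r => .got false (r 1)
      else .feed (fun _ => false) .fin
    | .half e, S =>
      if j ∈ S then .query {1} fun r => .got e (r 1) else .feed (single i e) .fin
    | .got e e', _ => .feed (fun o => if o = i then e else e') .fin
    | .fin, _ => .halt false
  onHalt
    | .start, v => .halt v
    | .fin, v => .halt v
    | _, _ => .halt false

variable {M : OracleTM (Fin 2)} {i j : Fin 2} {E : Fin 2 → Bool} {O O' : Fin 2 → Language Bool}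
  {T : ℕ} {X : Fin 2 → List Bool} {Y : List Bool} {l : List (Finset (Fin 2))} {c : M.Cfg}
  {x : List Bool}

theorem sequential_fin (h : M.HaltsIn E T c) :
    (M.control (sequential i j)).Yields O (conf (sequential i j) .fin c X Y l) T
      (M.final c) Y l := by
  have hc : Commands (sequential i j) .fin (M.pause c) (.halt (M.final c)) :=
    h.commands_final (g := fun v => .halt v) (fun _ _ => rfl) fun _ => rfl
  refine Yields.mono (yields_conf_pause (yields_conf_halt (T := 0) hc rfl)) ?_
  have := h.pauseTime_le
  omega

/-- The verdict of `M` if it asks at most once, with oracles `O`. -/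
noncomputable def parallelVerdict (M : OracleTM (Fin 2)) (O : Fin 2 → Language Bool)
    (x : List Bool) : Bool :=
  match M.asks (M.pause (M.init x)) with
  | some S => M.final (M.reply (M.pause (M.init x)) (answers O S (M.pause (M.init x)).query))
  | none => M.final (M.init x)

theorem eq_or_eq_of_ne (hij : j ≠ i) (o : Fin 2) : o = i ∨ o = j := by
  omega

theorem sequential_start (hij : j ≠ i) (hi : O' i = O 0) (hj : O' j = O 1)
    (h : ∀ E, M.HaltsIn E T (M.init x)) :
    ∃ l', l'.Sublist [{0}, {1}] ∧
    (M.control (sequential i j)).Yields O (conf (sequential i j) .start (M.init x) X Y []) (T + 3)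
      (M.parallelVerdict O' x) Y l' := by
  classical
  have hT := (h fun _ => false).pauseTime_le
  unfold parallelVerdict
  rcases (h fun _ => false).verdict_or_asks with ⟨v, hv⟩ | ⟨S, hS⟩
  · rw [asks_of_verdict hv]
    refine ⟨[], by simp, ?_⟩
    rw [final_eq hv]
    exact Yields.mono (yields_conf_pause (yields_conf_halt (T := 0) (.inr ⟨v, hv, rfl⟩) rfl))
      (by omega)
  simp only [hS]
  set s := M.pause (M.init x) with hs
  have hpos := (h fun _ => false).pause.pos hS
  have h1 : M.HaltsIn (answers O' S s.query) (T - M.pauseTime (M.init x) - 1)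
      (M.reply s (answers O' S s.query)) := by
    convert (h (answers O' S s.query)).pause.reply hS using 2
    funext o
    by_cases ho : o ∈ S <;> simp [answers, ho]
  by_cases hiS : i ∈ S
  · by_cases hjS : j ∈ S
    · refine ⟨[{0}, {1}], by simp, ?_⟩
      have ha : answers O' S s.query = fun o =>
          if o = i then decide (s.query i ∈ O 0) else decide (s.query j ∈ O 1) := by
        funext o
        rcases eq_or_eq_of_ne hij o with rfl | rfl
        · simp [answers, hiS, hi]
        · simp [answers, hjS, hj, hij]
      rw [ha] at h1 ⊢
      refine Yields.mono (yields_conf_pause (yields_conf_query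
        (a := single 0 (decide (s.query i ∈ O 0))) (X' := fun _ => []) (Y' := Y)
        (.inl ⟨S, hS, if_pos hiS⟩)
        ((answers_singleton _ _ _).trans ?_) ?_ rfl (yields_conf_query
        (a := single 1 (decide (s.query j ∈ O 1))) (X' := fun _ => []) (Y' := Y)
        (.inl ⟨S, hS, if_pos hjS⟩)
        ((answers_singleton _ _ _).trans ?_) ?_ rfl (yields_conf_feed hS rfl (fun _ => rfl) rfl
        (sequential_fin h1)))))
        (by omega)
      · rfl
      · intro o; fin_cases o <;> rfl
      · rfl
      · intro o; fin_cases o <;> rfl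
    · refine ⟨[{0}], by simp, ?_⟩
      have ha : answers O' S s.query = single i (decide (s.query i ∈ O 0)) := by
        funext o
        rcases eq_or_eq_of_ne hij o with rfl | rfl
        · simp [answers, single, hiS, hi]
        · simp [answers, single, hjS, hij]
      rw [ha] at h1 ⊢
      refine Yields.mono (yields_conf_pause (yields_conf_query
        (a := single 0 (decide (s.query i ∈ O 0))) (X' := fun _ => []) (Y' := Y)
        (.inl ⟨S, hS, if_pos hiS⟩)
        ((answers_singleton _ _ _).trans ?_) ?_ rfl
        (yields_conf_feed hS (if_neg hjS) (X' := ![[], s.query j]) ?_ rfl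
        (sequential_fin h1)))) (by omega)
      · rfl
      · intro o; fin_cases o <;> rfl
      · intro o; fin_cases o <;> rfl
  · by_cases hjS : j ∈ S
    · refine ⟨[{1}], by simp, ?_⟩
      have ha : answers O' S s.query = fun o =>
          if o = i then false else decide (s.query j ∈ O 1) := by
        funext o
        rcases eq_or_eq_of_ne hij o with rfl | rfl
        · simp [answers, hiS]
        · simp [answers, hjS, hj, hij]
      rw [ha] at h1 ⊢
      refine Yields.mono (yields_conf_pause (yields_conf_query
        (a := single 1 (decide (s.query j ∈ O 1))) (X' := ![s.query i, []]) (Y' := Y)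
        (.inl ⟨S, hS, (if_neg hiS).trans (if_pos hjS)⟩)
        ((answers_singleton _ _ _).trans ?_) ?_ rfl (yields_conf_feed hS rfl (fun _ => rfl) rfl
        (sequential_fin h1)))) (by omega)
      · rfl
      · intro o; fin_cases o <;> rfl
    · refine ⟨[], by simp, ?_⟩
      have ha : answers O' S s.query = fun _ => false := by
        funext o
        rcases eq_or_eq_of_ne hij o with rfl | rfl
        · simp [answers, hiS]
        · simp [answers, hjS]
      rw [ha] at h1 ⊢
      exact Yields.mono (yields_conf_pause (yields_conf_feed hS ((if_neg hiS).trans (if_neg hjS))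
        (fun _ => rfl) rfl (sequential_fin h1))) (by omega)

theorem sequential_init (hij : j ≠ i) (hi : O' i = O 0) (hj : O' j = O 1)
    (h : ∀ E, M.HaltsIn E T (M.init x)) :
    ∃ l', l'.Sublist [{0}, {1}] ∧
    (M.control (sequential i j)).Yields O ((M.control (sequential i j)).init x)
      (T + 3 + (2 * x.length + 2)) (M.parallelVerdict O' x) [] l' := by
  obtain ⟨l', hl', hy⟩ := sequential_start (X := fun _ => []) (Y := []) hij hi hj h
  exact ⟨l', hl', yields_init (fun _ => rfl) rfl hy⟩

end OracleTM

end QueryOrder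

namespace QueryOrder

namespace OracleTM
/-! ### The verdict of the given machine -/

section

variable {ι : Type} [DecidableEq ι] {M : OracleTM ι} {O : ι → Language Bool} {x : List Bool}
  {c : M.Cfg} {i j : ι}

theorem Reaches.verdict_or_asks (h : M.Reaches O x c) (hM : M.PolyTime) :
    (∃ v, M.verdict (M.pause c) = some v) ∨ ∃ S, M.asks (M.pause c) = some S := by
  obtain ⟨t, rfl⟩ := h
  obtain ⟨p, hp⟩ := hM
  obtain ⟨s, -, b, hb⟩ := hp O x
  refine verdict_or_asks_of_not_isMove (pauseTime_le_and_not_isMove (O := O) (t := s) (b := b) ?_).2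
  rw [← run_add, run_eq_of_verdict hb (by omega), hb]

/-- Any further query would violate `R`, so `M` runs from `c` to its verdict without asking. -/
theorem Reaches.mem_accepted_iff_final {R : List (Finset ι) → Prop} (h : M.Reaches O x c)
    (hM : M.PolyTime) (hR : M.Obeys O R) (hc : ∀ S, ¬ R (c.log ++ [S])) :
    x ∈ M.accepted O ↔ M.final c = true := by
  rcases h.verdict_or_asks hM with ⟨v, hv⟩ | ⟨S, hS⟩
  · rw [final_eq hv, h.pause.mem_accepted_iff hv]
  · have := (h.pause.reply hS).obeys hR
    rw [M.reply_log hS, M.pause_log] at this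
    exact (hc S this).elim

/-- The logs of machines that ask each of `i` and `j` at most once. -/
def AtMostOnceEach (i j : ι) (l : List (Finset ι)) : Prop :=
  l.Sublist [{i}, {j}] ∨ l.Sublist [{j}, {i}]

theorem AtMostOnceEach.symm {l : List (Finset ι)} (h : AtMostOnceEach i j l) :
    AtMostOnceEach j i l :=
  Or.symm h

theorem AtMostOnceEach.length_le {l : List (Finset ι)} (h : AtMostOnceEach i j l) :
    l.length ≤ 2 := by
  rcases h with h | h <;> exact h.length_le

theorem AtMostOnceEach.eq_or_eq {S : Finset ι} (h : AtMostOnceEach i j [S]) :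
    S = {i} ∨ S = {j} := by
  rcases h with h | h <;> simpa [or_comm] using h

theorem AtMostOnceEach.eq_of_ne {S : Finset ι} (hij : j ≠ i) (h : AtMostOnceEach i j [{i}, S]) :
    S = {j} := by
  rcases h with h | h
  · have := h.eq_of_length rfl
    simpa using this
  · have := h.eq_of_length rfl
    simp [hij.symm] at this

theorem Reaches.mem_accepted_iff_finalAfterQuery (hij : j ≠ i) (h : M.Reaches O x c)
    (hM : M.PolyTime) (hR : M.Obeys O (AtMostOnceEach i j)) (hc : c.log = [{i}]) :
    x ∈ M.accepted O ↔ M.finalAfterQuery j (O j) c = true := by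
  rcases h.verdict_or_asks hM with ⟨v, hv⟩ | ⟨S, hS⟩
  · rw [finalAfterQuery, if_neg (by simp [asks_of_verdict hv]), final_eq hv,
      h.pause.mem_accepted_iff hv]
  · have h1 := h.pause.reply hS
    have h2 := h1.obeys hR
    rw [M.reply_log hS, M.pause_log, hc] at h2
    obtain rfl := h2.eq_of_ne hij
    rw [finalAfterQuery, if_pos hS, ← answers_singleton,
      h1.mem_accepted_iff_final hM hR]
    intro S' hS'
    rw [M.reply_log hS, M.pause_log, hc] at hS'
    simpa using hS'.length_le

-- For a positive answer, `v₋ xor [v₊ ≠ v₋] = v₊`, whatever `v₋` is; for a negative one, `x ∉ G` and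
-- `v₋` remains. So only the value on the branch with the true answer has to be the real verdict,
-- and there `M` obeys the query discipline.
open Classical in
theorem mem_accepted_iff_combinedVerdict (hij : j ≠ i) (hM : M.PolyTime)
    (hR : M.Obeys O (AtMostOnceEach i j)) {G : Language Bool}
    (hl : M.asks (M.pause (M.init x)) = some {i} → (x ∈ G ↔ (M.pause (M.init x)).query i ∈ O i ∧
      M.finalAfterQuery j (O j) (M.reply (M.pause (M.init x)) (single i true)) ≠
        M.finalAfterQuery j (O j) (M.reply (M.pause (M.init x)) (single i false))))
    (hr : M.asks (M.pause (M.init x)) = some {j} →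
      ∀ c, c = M.reply (M.pause (M.init x))
        (single j (decide ((M.pause (M.init x)).query j ∈ O j))) →
      M.asks (M.pause c) = some {i} → (x ∈ G ↔ (M.pause c).query i ∈ O i)) :
    x ∈ M.accepted O ↔ M.combinedVerdict i j G (O j) x = true := by
  have h := M.reaches_init O x
  unfold combinedVerdict
  rcases h.verdict_or_asks hM with ⟨v, hv⟩ | ⟨S, hS⟩
  · simp only [asks_of_verdict hv]
    rw [if_neg (by simp), if_neg (by simp), final_eq hv, h.pause.mem_accepted_iff hv]
  · have h1 := h.pause.reply hS
    have h2 : (M.reply (M.pause (M.init x)) (answers O S (M.pause (M.init x)).query)).log = [S] := by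
      rw [M.reply_log hS, M.pause_log]
      rfl
    have h3 := h1.obeys hR
    rw [h2] at h3
    rcases h3.eq_or_eq with rfl | rfl
    · simp only [hS, if_true]
      rw [h1.mem_accepted_iff_finalAfterQuery hij hM hR h2, answers_singleton]
      simp only [hl hS]
      by_cases hq : (M.pause (M.init x)).query i ∈ O i
      · simp only [hq, decide_true, true_and]
        generalize M.finalAfterQuery j (O j) (M.reply (M.pause (M.init x)) (single i true)) = a
        generalize M.finalAfterQuery j (O j) (M.reply (M.pause (M.init x)) (single i false)) = b
        cases a <;> cases b <;> simp
      · simp [hq]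
    · have hR' : M.Obeys O (AtMostOnceEach j i) := fun x t => (hR x t).symm
      have hne : M.asks (M.pause (M.init x)) ≠ some {i} := by simp [hS, hij]
      rw [if_neg hne, if_pos hS]
      rw [h1.mem_accepted_iff_finalAfterQuery hij.symm hM hR' h2, answers_singleton]
      have hr' := hr hS _ rfl
      rw [finalAfterQuery]
      by_cases hi : M.asks (M.pause (M.reply (M.pause (M.init x))
          (single j (decide ((M.pause (M.init x)).query j ∈ O j))))) = some {i}
      · simp only [hi, if_true, hr' hi]
      · simp only [hi, if_false]

end

theorem mem_accepted_iff_parallelVerdict {M : OracleTM (Fin 2)}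
    {O : Fin 2 → Language Bool} (hM : M.PolyTime) (hR : M.Obeys O fun l => l.length ≤ 1)
    (x : List Bool) : x ∈ M.accepted O ↔ M.parallelVerdict O x = true := by
  have h := M.reaches_init O x
  unfold parallelVerdict
  rcases h.verdict_or_asks hM with ⟨v, hv⟩ | ⟨S, hS⟩
  · simp only [asks_of_verdict hv]
    rw [final_eq hv, h.pause.mem_accepted_iff hv]
  · simp only [hS]
    refine (h.pause.reply hS).mem_accepted_iff_final hM hR fun S' hS' => ?_
    rw [M.reply_log hS, M.pause_log] at hS'
    simp [init] at hS'

end OracleTM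

open OracleTM

/-! ### Reductions -/

variable {𝒞 𝒟 : ComplexityClass}

theorem preimage_mem (hdown : ClosedDownward 𝒞 𝒟) {f : List Bool → List Bool}
    (hf : f ∈ FPOneQuery 𝒟) {B : Language Bool} (hB : B ∈ 𝒞) :
    ({x : List Bool | f x ∈ B} : Set (List Bool)) ∈ 𝒞 :=
  hdown _ B ⟨f, hf, fun _ => Iff.rfl⟩ hB

/-- A machine that halts at once. -/
def haltingMachine : OracleTM (Fin 1) where
  State := Unit
  Tape := Unit
  inp := ()
  start := ()
  δ _ _ := .halt true

theorem nil_mem_FPOneQuery {D : Language Bool} (hD : D ∈ 𝒟) :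
    (fun _ => []) ∈ FPOneQuery 𝒟 := by
  have hy : ∀ O x, haltingMachine.Yields O (haltingMachine.init x) 0 true [] [] := fun O x =>
    Yields.of_verdict rfl 0
  refine ⟨D, hD, haltingMachine, polyTime_of_yields 0 fun O x => ⟨_, _, _, (hy O x).mono ?_⟩,
    fun x t => ?_, fun x => ?_⟩
  · simp
  · rw [List.prefix_nil.1 ((hy ![D] x).log_prefix t)]
    simp
  · obtain ⟨t, -, hv, ho, -⟩ := hy ![D] x
    exact ⟨t, _, hv, ho⟩

/-- The empty word lies in no disjoint union, so the constant map to it pulls `C ⊕ C` back to `∅`.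
-/
theorem empty_mem (hdown : ClosedDownward 𝒞 𝒟) (hC : ClosedDisjointUnion 𝒞) {C D : Language Bool}
    (hCm : C ∈ 𝒞) (hDm : D ∈ 𝒟) : (∅ : Set (List Bool)) ∈ 𝒞 := by
  have := preimage_mem hdown (nil_mem_FPOneQuery hDm) (hC C hCm C hCm)
  convert this
  ext x
  constructor
  · exact False.elim
  · rintro (⟨y, -, hy⟩ | ⟨y, -, hy⟩) <;> simp at hy

theorem append_mem_disjointUnion_empty (C : Language Bool) (x : List Bool) (b : Bool) :
    x ++ [b] ∈ disjointUnion C (∅ : Set (List Bool)) ↔ x ∈ C ∧ b = false := by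
  constructor
  · rintro (⟨y, hy, h⟩ | ⟨y, hy, -⟩)
    · obtain ⟨rfl, h⟩ := List.append_inj' h rfl
      exact ⟨hy, by simpa using h⟩
    · exact hy.elim
  · rintro ⟨hx, rfl⟩
    exact .inl ⟨x, hx, rfl⟩

/-- The time bound must hold for all oracles, so the computation is described for every `O`,
although only the function at `![D]` is wanted. -/
theorem mem_FPOneQuery_of_yields {D : Language Bool} (hD : D ∈ 𝒟) {N : OracleTM (Fin 1)}
    (p : Polynomial ℕ) (f : (Fin 1 → Language Bool) → List Bool → List Bool)
    (h : ∀ O x, ∃ v l, l.length ≤ 1 ∧ N.Yields O (N.init x) (p.eval x.length) v (f O x) l) :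
    f ![D] ∈ FPOneQuery 𝒟 := by
  refine ⟨D, hD, N, polyTime_of_yields p fun O x => ?_, fun x t => ?_, fun x => ?_⟩
  · obtain ⟨v, l, -, hy⟩ := h O x
    exact ⟨_, _, _, hy⟩
  · obtain ⟨v, l, hl, hy⟩ := h ![D] x
    exact (hy.log_prefix t).length_le.trans hl
  · obtain ⟨v, l, hl, t, -, hv, ho, -⟩ := h ![D] x
    exact ⟨t, _, hv, ho⟩

section

variable {ι : Type} [DecidableEq ι] {M : OracleTM ι} {i j : ι}

theorem appendedBit_mem_FPOneQuery (hij : j ≠ i) (hM : M.PolyTime) {D : Language Bool}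
    (hD : D ∈ 𝒟) : (fun x => x ++ [M.appendedBit i j D x]) ∈ FPOneQuery 𝒟 := by
  obtain ⟨p, hp⟩ := hM
  refine mem_FPOneQuery_of_yields (N := M.control (appendBit i j)) hD
    (p + 6 + (2 * Polynomial.X + 2)) (fun O x => x ++ [M.appendedBit i j (O 0) x]) fun O x => ?_
  obtain ⟨l, hl, hy⟩ := appendBit_init (O := O) hij fun E => PolyTime.haltsIn hp E x
  refine ⟨true, l, hl, hy.mono ?_⟩
  simp

/-- The properties of the function computed by `reduceQuery`. -/
theorem exists_reduceQuery (hij : j ≠ i) (hM : M.PolyTime) {D : Language Bool} (hD : D ∈ 𝒟) :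
    ∃ f ∈ FPOneQuery 𝒟, ∀ x b,
      (M.asks (M.pause (M.init x)) = some {i} → f (x ++ [b]) = (M.pause (M.init x)).query i ++
        [M.finalAfterQuery j D (M.reply (M.pause (M.init x)) (single i true)) == b]) ∧
      (M.asks (M.pause (M.init x)) = some {j} → f (x ++ [b]) =
        (M.pause (M.reply (M.pause (M.init x)) (single j b))).query i ++
        [decide (M.asks (M.pause (M.reply (M.pause (M.init x)) (single j b))) ≠ some {i})]) := by
  obtain ⟨p, hp⟩ := hM
  have h := fun w : List Bool => fun E => PolyTime.haltsIn hp E w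
  have hy : ∀ O w, ∃ o, ∃ l : List (Finset (Fin 1)), l.length ≤ 1 ∧
      (M.control (reduceQuery i j)).Yields O ((M.control (reduceQuery i j)).init w)
        ((p + 6 + (2 * Polynomial.X + 2)).eval w.length) true o l ∧
      ∀ x b, w = x ++ [b] →
      (M.asks (M.pause (M.init x)) = some {i} → o = (M.pause (M.init x)).query i ++
        [M.finalAfterQuery j (O 0) (M.reply (M.pause (M.init x)) (single i true)) == b]) ∧
      (M.asks (M.pause (M.init x)) = some {j} → o =
        (M.pause (M.reply (M.pause (M.init x)) (single j b))).query i ++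
        [decide (M.asks (M.pause (M.reply (M.pause (M.init x)) (single j b))) ≠ some {i})]) := by
    intro O w
    have hle : p.eval w.dropLast.length + 6 + (2 * w.length + 2) ≤
        (p + 6 + (2 * Polynomial.X + 2)).eval w.length := by
      -- `M` runs on the shortened input, while the bound is in terms of the full one.
      have := polynomial_eval_mono p (m := w.dropLast.length) (n := w.length) (by simp)
      simpa using this
    by_cases hi : M.asks (M.pause (M.init w.dropLast)) = some {i}
    · obtain ⟨l, hl, hy⟩ := reduceQuery_start_of_asks_left (O := O) (X := fun _ => []) (Y := [])
        (l := []) (b := w.getLast?.getD false) hij (h w.dropLast) hi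
      refine ⟨_, l, hl, (reduceQuery_init hy).mono hle, ?_⟩
      rintro x b rfl
      rw [List.dropLast_concat] at hi
      simp [hi, hij.symm]
    by_cases hj : M.asks (M.pause (M.init w.dropLast)) = some {j}
    · have hy := reduceQuery_start_of_asks_right (O := O) (X := fun _ => []) (Y := [])
        (l := []) (b := w.getLast?.getD false) hij (h w.dropLast) hj
      refine ⟨_, [], by simp, (reduceQuery_init hy).mono hle, ?_⟩
      rintro x b rfl
      rw [List.dropLast_concat] at hj
      simp [hj, hij]
    · obtain ⟨o, l, hl, hy⟩ := reduceQuery_start (O := O) (X := fun _ => []) (Y := [])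
        (l := []) (b := w.getLast?.getD false) hij (h w.dropLast)
      refine ⟨o, l, hl, (reduceQuery_init hy).mono hle, ?_⟩
      rintro x b rfl
      rw [List.dropLast_concat] at hi hj
      simp [hi, hj]
  choose f l hl hy hf using hy
  exact ⟨f ![D], mem_FPOneQuery_of_yields hD _ f fun O x => ⟨true, l O x, hl O x, hy O x⟩,
    fun x b => hf ![D] _ x b rfl⟩

end

/-! ### The inclusions -/

theorem mem_PParallel (hdown : ClosedDownward 𝒞 𝒟) (hC : ClosedDisjointUnion 𝒞)
    {M : OracleTM (Fin 2)} {i j : Fin 2} (hij : j ≠ i) (hM : M.PolyTime)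
    {O : Fin 2 → Language Bool} (hR : M.Obeys O (AtMostOnceEach i j)) (hi : O i ∈ 𝒞)
    (hj : O j ∈ 𝒟) : M.accepted O ∈ PParallel 𝒞 𝒟 := by
  classical
  obtain ⟨f, hf, hfs⟩ := exists_reduceQuery hij hM hj
  -- Membership in `B` tests the query to `O i` and the final bit `0` together.
  set B := disjointUnion (O i) (∅ : Set (List Bool)) with hB
  have hBm : B ∈ 𝒞 := hC _ hi _ (empty_mem hdown hC hi hj)
  set G : Language Bool := {x : List Bool | f (x ++ [M.appendedBit i j (O j) x]) ∈ B} with hG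
  -- The composition may ask `O j` twice, so closure is used separately for the outer and the inner
  -- map.
  have hGm : G ∈ 𝒞 := preimage_mem hdown (appendedBit_mem_FPOneQuery hij hM hj)
    (preimage_mem hdown hf hBm)
  have hGx : ∀ x, x ∈ G ↔ f (x ++ [M.appendedBit i j (O j) x]) ∈ B := fun _ => Iff.rfl
  have hacc : ∀ x, x ∈ M.accepted O ↔ M.combinedVerdict i j G (O j) x = true := by
    intro x
    refine mem_accepted_iff_combinedVerdict hij hM hR (fun h => ?_) fun h c hc hci => ?_
    · rw [hGx, (hfs x _).1 h, append_mem_disjointUnion_empty, appendedBit]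
      simp [h]
    · rw [hGx, (hfs x _).2 h, append_mem_disjointUnion_empty, appendedBit]
      have hne : M.asks (M.pause (M.init x)) ≠ some {i} := by simp [h, hij]
      simp only [if_neg hne, if_pos h, ← hc]
      simp [hci]
  obtain ⟨p, hp⟩ := id hM
  have hy : ∀ (O' : Fin 2 → Language Bool) x, ∃ l' : List (Finset (Fin 2)), l'.length ≤ 1 ∧
      (M.control (combine i j)).Yields O' ((M.control (combine i j)).init x)
        ((p + 6 + (2 * Polynomial.X + 2)).eval x.length)
        (M.combinedVerdict i j (O' 0) (O' 1) x) [] l' := by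
    intro O' x
    obtain ⟨l, hl, hy⟩ := combine_init (O := O') hij fun E => PolyTime.haltsIn hp E x
    exact ⟨l, hl, hy.mono (by simp)⟩
  refine ⟨G, hGm, O j, hj, M.control (combine i j),
    polyTime_of_yields (p + 6 + (2 * Polynomial.X + 2)) fun O' x => ?_,
    fun x t => ?_, Set.ext fun x => ?_⟩
  · obtain ⟨l, hl, h⟩ := hy O' x
    exact ⟨_, _, _, h⟩
  · obtain ⟨l, hl, h⟩ := hy ![G, O j] x
    exact (h.log_prefix t).length_le.trans hl
  · obtain ⟨l, hl, h⟩ := hy ![G, O j] x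
    exact (hacc x).trans h.mem_accepted_iff.symm

/-- Leaving `i` and `j` free yields both orders of the two queries. -/
theorem mem_POrdered {M : OracleTM (Fin 2)} {i j : Fin 2} (hij : j ≠ i) (hM : M.PolyTime)
    {O : Fin 2 → Language Bool} (hR : M.Obeys O fun l => l.length ≤ 1) (hi : O i ∈ 𝒞)
    (hj : O j ∈ 𝒟) : M.accepted O ∈ POrdered 𝒞 𝒟 := by
  obtain ⟨p, hp⟩ := id hM
  have hy : ∀ (O₁ O₂ : Fin 2 → Language Bool) (_ : O₁ i = O₂ 0) (_ : O₁ j = O₂ 1) x,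
      ∃ l' : List (Finset (Fin 2)), l'.Sublist [{0}, {1}] ∧
      (M.control (sequential i j)).Yields O₂ ((M.control (sequential i j)).init x)
        ((p + 3 + (2 * Polynomial.X + 2)).eval x.length) (M.parallelVerdict O₁ x) [] l' := by
    intro O₁ O₂ h0 h1 x
    obtain ⟨l, hl, hy⟩ := sequential_init hij h0 h1 fun E => PolyTime.haltsIn hp E x
    exact ⟨l, hl, hy.mono (by simp)⟩
  refine ⟨O i, hi, O j, hj, M.control (sequential i j),
    polyTime_of_yields (p + 3 + (2 * Polynomial.X + 2)) fun O' x => ?_,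
    fun x t => ?_, Set.ext fun x => ?_⟩
  -- For arbitrary oracles of the new machine, `M` is run with the same oracles reindexed.
  · obtain ⟨l, hl, h⟩ := hy (fun o => if o = i then O' 0 else O' 1) O' (by simp) (by simp [hij]) x
    exact ⟨_, _, _, h⟩
  · obtain ⟨l, hl, h⟩ := hy O ![O i, O j] rfl rfl x
    exact (h.log_prefix t).sublist.trans hl
  · obtain ⟨l, hl, h⟩ := hy O ![O i, O j] rfl rfl x
    exact (mem_accepted_iff_parallelVerdict hM hR x).trans h.mem_accepted_iff.symm

end QueryOrder

open QueryOrder in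
theorem corollaryc (𝒞 𝒟 : QueryOrder.ComplexityClass)
    (hdown : QueryOrder.ClosedDownward 𝒞 𝒟)
    (hC : QueryOrder.ClosedDisjointUnion 𝒞)
    (hD : QueryOrder.ClosedDisjointUnion 𝒟) :
    QueryOrder.PParallel 𝒞 𝒟 = QueryOrder.POrdered 𝒞 𝒟 ∧
      QueryOrder.POrdered 𝒞 𝒟 = QueryOrder.POrdered 𝒟 𝒞 ∧
      QueryOrder.POrdered 𝒟 𝒞 = QueryOrder.PUnordered 𝒞 𝒟 := by
  have h1 : PParallel 𝒞 𝒟 ⊆ POrdered 𝒞 𝒟 := by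
    rintro _ ⟨C, hC, D, hD, M, hM, hR, rfl⟩
    exact mem_POrdered (i := 0) (j := 1) (by decide) hM hR hC hD
  have h2 : PParallel 𝒞 𝒟 ⊆ POrdered 𝒟 𝒞 := by
    rintro _ ⟨C, hC, D, hD, M, hM, hR, rfl⟩
    exact mem_POrdered (i := 1) (j := 0) (by decide) hM hR hD hC
  have h3 : POrdered 𝒞 𝒟 ⊆ PUnordered 𝒞 𝒟 := by
    rintro _ ⟨C, hC, D, hD, M, hM, hR, rfl⟩
    exact ⟨C, hC, D, hD, M, hM, fun x t => .inl (hR x t), rfl⟩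
  have h4 : PUnordered 𝒞 𝒟 ⊆ PParallel 𝒞 𝒟 := by
    rintro _ ⟨C, hCm, D, hDm, M, hM, hR, rfl⟩
    exact mem_PParallel hdown hC (i := 0) (j := 1) (by decide) hM hR hCm hDm
  have h5 : POrdered 𝒟 𝒞 ⊆ PParallel 𝒞 𝒟 := by
    rintro _ ⟨D, hDm, C, hCm, M, hM, hR, rfl⟩
    -- Here the machine has `D` as oracle `0` and `C` as oracle `1`.
    exact mem_PParallel hdown hC (i := 1) (j := 0) (by decide) hM
      (fun x t => .inr (hR x t)) hCm hDm
  exact ⟨h1.antisymm (h3.trans h4), (h3.trans (h4.trans h2)).antisymm (h5.trans h1),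
    (h5.trans (h1.trans h3)).antisymm (h4.trans h2)⟩
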